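/- Let $N=2$ or $3$, write points of $\mathbb{R}^N$ as $(x',x_N)\in\mathbb{R}^{N-1}\times\mathbb{R}$ and let $\mathbb{R}^N_+=\mathbb{R}^{N-1}\times(0,+\infty)$. Let $$A(x')=\begin{pmatrix}\widehat A(x') & 0\\ 0 & 1\end{pmatrix},$$ where $\widehat A(x')$ is a real symmetric $(N-1)\times(N-1)$ matrix with entries $a_{ij}\in C^1(\mathbb{R}^{N-1})\cap L^\infty(\mathbb{R}^{N-1})$ such that $\sum_{i,j}a_{ij}(x')\xi_i\xi_j>0$ for all $x'\in\mathbb{R}^{N-1}$ and all $\xi\in\mathbb{R}^{N-1}\setminus\{0\}$. Let $g\in C(\mathbb{R})$ and put $$c_m=\frac1\pi\int_0^{2\pi}g(t)\cos(mt)\,dt\quad(m\ge0),\qquad d_m=\frac1\pi\int_0^{2\pi}g(t)\sin(mt)\,dt\quad(m\ge1).$$ Assume $c_1\ge0$ and $d_1\ge0$. Suppose that $u\in C^2(\overline{\mathbb{R}^N_+})$ solves $$-\mathrm{div}\big(A(x')\nabla u\big)=u-g(x_N)\ \text{ in }\mathbb{R}^N_+,\qquad u=0\ \text{ on }\partial\mathbb{R}^N_+,$$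 and that for every $M>0$ there is $C(M)>0$ with $0\le u\le C(M)$ on $\mathbb{R}^{N-1}\times[0,M]$. Then $c_1=d_1=0$. Moreover, on $\mathbb{R}^{N-1}\times[0,2\pi]$ the function $u$ depends only on $x_N$, and there it equals the unique solution $v\in C^2(0,2\pi)\cap C^1[0,2\pi]$ of $$-v''=v-g\ \text{ in }(0,2\pi),\qquad v(0)=v(2\pi)=0,\qquad v'(0)=v'(2\pi)=0.$$ In particular, for all $x'\in\mathbb{R}^{N-1}$ and $x_N\in[0,2\pi]$, $$u(x',x_N)=\frac{c_0}{2}+\Big(-\frac{c_0}{2}+\sum_{m=2}^{\infty}\frac{c_m}{m^2-1}\Big)\cos x_N+\Big(\sum_{m=2}^{\infty}\frac{m}{m^2-1}d_m\Big)\sin x_N-\sum_{m=2}^{\infty}\Big(\frac{c_m}{m^2-1}\cos(mx_N)+\frac{d_m}{m^2-1}\sin(mx_N)\Big),$$ where all the series converge absolutely. -/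

import Mathlib

open Set

/-- A point `(x', x_N)` of `ℝ^N = ℝ^{N-1} × ℝ`, with `n = N - 1`. -/
abbrev Pt (n : ℕ) : Type := EuclideanSpace ℝ (Fin n) × ℝ

/-- The standard basis of `ℝ^N`: the `N - 1` horizontal directions, indexed by `Fin n`, and the
vertical direction `x_N`, indexed by `Unit`. -/
noncomputable def basisDir {n : ℕ} : Fin n ⊕ Unit → Pt n
  | Sum.inl i => (EuclideanSpace.single i 1, 0)
  | Sum.inr _ => (0, 1)

/-- The partial derivative `∂_i f (x)`. -/
noncomputable def partialD {n : ℕ} (i : Fin n ⊕ Unit) (f : Pt n → ℝ) (x : Pt n) : ℝ :=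
  fderiv ℝ f x (basisDir i)

/-- The operator `div (A(x) ∇u) = ∑_i ∂_i (∑_j a_{ij} ∂_j u)` on `ℝ^N`. -/
noncomputable def divForm {n : ℕ} (A : Pt n → Matrix (Fin n ⊕ Unit) (Fin n ⊕ Unit) ℝ)
    (u : Pt n → ℝ) (x : Pt n) : ℝ :=
  ∑ i, partialD i (fun y => ∑ j, A y i j * partialD j u y) x

/-- The `N × N` block matrix `A(x') = diag(Â(x'), 1)`, where `Â = B`. -/
def blockMatrix {n : ℕ} (B : EuclideanSpace ℝ (Fin n) → Matrix (Fin n) (Fin n) ℝ) (x : Pt n) :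
    Matrix (Fin n ⊕ Unit) (Fin n ⊕ Unit) ℝ :=
  Matrix.fromBlocks (B x.1) 0 0 1

/-- The assumptions on `Â = B`: symmetric, with bounded `C¹` entries, and pointwise
(not necessarily uniformly) positive definite. -/
structure IsAdmissible {n : ℕ} (B : EuclideanSpace ℝ (Fin n) → Matrix (Fin n) (Fin n) ℝ) :
    Prop where
  symm : ∀ x', (B x').IsSymm
  contDiff : ∀ i j, ContDiff ℝ 1 (fun x' => B x' i j)
  bounded : ∀ i j, ∃ K : ℝ, ∀ x', |B x' i j| ≤ K
  pos : ∀ x' (ξ : Fin n → ℝ), ξ ≠ 0 → 0 < ∑ i, ∑ j, B x' i j * ξ i * ξ j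

/-- `u ∈ C²` of the closed half space (i.e. `C²` up to the boundary) is a classical solution of
`-div (A(x) ∇u) = u - g(x_N)` in `ℝ^N_+ = ℝ^{N-1} × (0, ∞)`, `u = 0` on `∂ℝ^N_+`. -/
structure IsHalfSpaceSolution {n : ℕ} (A : Pt n → Matrix (Fin n ⊕ Unit) (Fin n ⊕ Unit) ℝ)
    (g : ℝ → ℝ) (u : Pt n → ℝ) : Prop where
  contDiffOn : ContDiffOn ℝ 2 u {x | 0 ≤ x.2}
  equation : ∀ x : Pt n, 0 < x.2 → -divForm A u x = u x - g x.2
  boundary : ∀ x' : EuclideanSpace ℝ (Fin n), u (x', 0) = 0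

/-- `u` is nonnegative and bounded on every strip `ℝ^{N-1} × [0, M]`. -/
def NonnegBoundedOnStrips {n : ℕ} (u : Pt n → ℝ) : Prop :=
  ∀ M : ℝ, 0 < M → ∃ C : ℝ, 0 < C ∧ ∀ x : Pt n, x.2 ∈ Icc 0 M → 0 ≤ u x ∧ u x ≤ C

/-- The cosine Fourier coefficient `c_m` of `g` on `(0, 2π)`. -/
noncomputable def cosCoeff (g : ℝ → ℝ) (m : ℕ) : ℝ :=
  1 / Real.pi * ∫ t in (0 : ℝ)..(2 * Real.pi), g t * Real.cos (m * t)

/-- The sine Fourier coefficient `d_m` of `g` on `(0, 2π)`. -/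
noncomputable def sinCoeff (g : ℝ → ℝ) (m : ℕ) : ℝ :=
  1 / Real.pi * ∫ t in (0 : ℝ)..(2 * Real.pi), g t * Real.sin (m * t)

/-- `v ∈ C²(0, 2π) ∩ C¹[0, 2π]` is a classical solution of `-v'' = v - g` in `(0, 2π)`,
`v(0) = v(2π) = v'(0) = v'(2π) = 0` (one-sided derivatives at the end points). -/
structure IsODESolution (g v : ℝ → ℝ) : Prop where
  contDiffOn_Ioo : ContDiffOn ℝ 2 v (Ioo 0 (2 * Real.pi))
  contDiffOn_Icc : ContDiffOn ℝ 1 v (Icc 0 (2 * Real.pi))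
  equation : ∀ t ∈ Ioo 0 (2 * Real.pi), -deriv (deriv v) t = v t - g t
  left : v 0 = 0
  right : v (2 * Real.pi) = 0
  deriv_left : derivWithin v (Icc 0 (2 * Real.pi)) 0 = 0
  deriv_right : derivWithin v (Icc 0 (2 * Real.pi)) (2 * Real.pi) = 0

/-- `c_m / (m² - 1)`. -/
noncomputable def cosRatio (g : ℝ → ℝ) (m : ℕ) : ℝ := cosCoeff g m / ((m : ℝ) ^ 2 - 1)

/-- `d_m / (m² - 1)`. -/
noncomputable def sinRatio (g : ℝ → ℝ) (m : ℕ) : ℝ := sinCoeff g m / ((m : ℝ) ^ 2 - 1)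

/-!
The proof tests the equation against the functions `cos (m t)` and `sin (m t)` on the vertical
segment `[0, 2π]`. Every mode `w(x') = ∫₀^{2π} u(x', t) φ(t) dt` with `φ'' = -m² φ` is a bounded
function on `ℝ^{N-1}` which satisfies
`div (Â ∇w) = (m² - 1) w + ∫ g φ - [u_t φ - u φ']₀^{2π}`
(`IsHalfSpaceSolution.mode_equation`).

For `m = 1` the zeroth order term disappears. With `φ = sin` the right-hand side is
`π d₁ + u(x', 2π) ≥ 0`, so `w` is a bounded subsolution on a space of dimension at most `2`, hence
constant (`fderiv_eq_zero_of_subsolution`). Therefore `d₁ = 0` and `u(·, 2π) = 0`, and since `u ≥ 0`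
also `u_t(·, 2π) = 0`. With `φ = cos` the right-hand side is then `π c₁ + u_t(x', 0) ≥ 0`, and in the
same way `c₁ = 0` and `u_t(·, 0) = 0`. Now `u` has vanishing Cauchy data at heights `0` and `2π`, so
for `m ≥ 2` the modes solve `div (Â ∇w) = (m² - 1) w + const` and are explicit constants
(`IsHalfSpaceSolution.coeff_eq`).

For `m = 0` the zeroth order term has the wrong sign, and the mode cannot be shown to be constant
in this way. Instead, inverting the Fourier series of `u(x', ·)` and of `u_t(x', ·)` at `t = 0`
expresses the coefficients of index `1` through the others (`eq_series_of_coeff`). Since the cosine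
coefficient of index `1` is constant in `x'`, so is the mean of `u(x', ·)`, and then the equation for
`m = 0` identifies it with that of `g`. This gives the series for `u`, which does not involve `x'`.

The Liouville theorem `fderiv_eq_zero_of_bounded` rests on Caccioppoli's inequality
(`integral_energy_le`) and on the scaling of the Dirichlet integral in dimension at most `2`
(`exists_cutoff`). They bound the energy `a_k` of `w` on the ball of radius `2^k` uniformly in `k`,
and by a multiple of the energy `a_{k+1} - a_k` on an annulus, up to an arbitrarily small constant;
hence all `a_k` vanish (`eq_zero_of_le_mul_sub_add`). Only pointwise positivity of `Â` and an upper
bound are used, so no uniform ellipticity is required.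
-/

/-! ### Fourier series of real functions on `[0, 2π]` -/

open MeasureTheory Complex in
theorem fourierCoeffOn_ofReal_eq {g : ℝ → ℝ} (hg : ContinuousOn g (Icc 0 (2 * Real.pi)))
    (n : ℤ) :
    fourierCoeffOn Real.two_pi_pos (fun x => (g x : ℂ)) n =
      ((1 / Real.pi * ∫ t in (0 : ℝ)..(2 * Real.pi), g t * Real.cos (n * t) : ℝ)
        - (1 / Real.pi * ∫ t in (0 : ℝ)..(2 * Real.pi), g t * Real.sin (n * t) : ℝ) * I) / 2 := by
  rw [fourierCoeffOn_eq_integral]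
  have hg' : ContinuousOn g (uIcc 0 (2 * Real.pi)) := by
    rwa [uIcc_of_le Real.two_pi_pos.le]
  have hc : IntervalIntegrable (fun t => ((g t * Real.cos (n * t) : ℝ) : ℂ)) volume 0
      (2 * Real.pi) := by
    apply ContinuousOn.intervalIntegrable
    exact Complex.continuous_ofReal.comp_continuousOn
      (hg'.mul (by fun_prop : Continuous fun t : ℝ => Real.cos (n * t)).continuousOn)
  have hs : IntervalIntegrable (fun t => ((g t * Real.sin (n * t) : ℝ) : ℂ) * I) volume 0
      (2 * Real.pi) := by
    apply ContinuousOn.intervalIntegrable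
    exact (Complex.continuous_ofReal.comp_continuousOn
      (hg'.mul (by fun_prop : Continuous fun t : ℝ => Real.sin (n * t)).continuousOn)).mul
        continuousOn_const
  have key : ∀ t : ℝ, fourier (-n) (t : AddCircle (2 * Real.pi - 0)) • (g t : ℂ) =
      ((g t * Real.cos (n * t) : ℝ) : ℂ) - ((g t * Real.sin (n * t) : ℝ) : ℂ) * I := by
    intro t
    rw [fourier_coe_apply]
    have : 2 * (Real.pi : ℂ) * I * ((-n : ℤ) : ℂ) * t / ((2 * Real.pi - 0 : ℝ) : ℂ)
        = ((-(n * t) : ℝ) : ℂ) * I := by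
      push_cast
      field_simp
      ring
    rw [this, Complex.exp_ofReal_mul_I, Real.cos_neg, Real.sin_neg, smul_eq_mul]
    push_cast
    ring
  simp_rw [key]
  rw [intervalIntegral.integral_sub hc hs, intervalIntegral.integral_mul_const,
    intervalIntegral.integral_ofReal, intervalIntegral.integral_ofReal, Complex.real_smul]
  push_cast
  field_simp
  ring

theorem fourierCoeffOn_natCast {g : ℝ → ℝ} (hg : ContinuousOn g (Icc 0 (2 * Real.pi))) (m : ℕ) :
    fourierCoeffOn Real.two_pi_pos (fun x => (g x : ℂ)) (m : ℤ) =
      ((cosCoeff g m : ℂ) - (sinCoeff g m : ℂ) * Complex.I) / 2 := by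
  rw [fourierCoeffOn_ofReal_eq hg]
  simp [cosCoeff, sinCoeff]

theorem fourierCoeffOn_neg_natCast {g : ℝ → ℝ} (hg : ContinuousOn g (Icc 0 (2 * Real.pi)))
    (m : ℕ) :
    fourierCoeffOn Real.two_pi_pos (fun x => (g x : ℂ)) (-(m : ℤ)) =
      ((cosCoeff g m : ℂ) + (sinCoeff g m : ℂ) * Complex.I) / 2 := by
  rw [fourierCoeffOn_ofReal_eq hg]
  simp [cosCoeff, sinCoeff]

/-- **Bessel's inequality**, in qualitative form. -/
theorem summable_sq_coeff {g : ℝ → ℝ} (hg : ContinuousOn g (Icc 0 (2 * Real.pi))) :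
    Summable (fun m => cosCoeff g m ^ 2 + sinCoeff g m ^ 2) := by
  have hmem : MeasureTheory.MemLp (fun x => (g x : ℂ)) 2
      (MeasureTheory.volume.restrict (Ioc 0 (2 * Real.pi))) := by
    refine MeasureTheory.MemLp.mono_measure
      (MeasureTheory.Measure.restrict_mono Ioc_subset_Icc_self le_rfl) ?_
    have hgC := Complex.continuous_ofReal.comp_continuousOn hg
    obtain ⟨C, hC⟩ := isCompact_Icc.exists_bound_of_continuousOn hgC
    exact MeasureTheory.MemLp.of_bound (hgC.aestronglyMeasurable measurableSet_Icc) C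
      ((MeasureTheory.ae_restrict_iff' measurableSet_Icc).2 (.of_forall hC))
  have h := (hasSum_sq_fourierCoeffOn Real.two_pi_pos hmem).summable.comp_injective
    (i := fun m : ℕ => (m : ℤ)) Nat.cast_injective
  refine (h.mul_left 4).congr fun m => ?_
  have h2 : ((cosCoeff g m : ℂ) - (sinCoeff g m : ℂ) * Complex.I) / 2
      = ((cosCoeff g m / 2 : ℝ) : ℂ) + ((-sinCoeff g m / 2 : ℝ) : ℂ) * Complex.I := by
    push_cast; ring
  simp only [Function.comp_apply]
  rw [fourierCoeffOn_natCast hg, h2, ← Complex.normSq_eq_norm_sq, Complex.normSq_add_mul_I]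
  ring

/-- **Pointwise Fourier inversion** on `[0, 2π]` for a real function whose Fourier coefficients are
summable. -/
theorem hasSum_fourier_of_summable {f : ℝ → ℝ} (hf : ContinuousOn f (Icc 0 (2 * Real.pi)))
    (h0 : f 0 = f (2 * Real.pi)) (hc : Summable (cosCoeff f)) (hd : Summable (sinCoeff f))
    {t : ℝ} (ht : t ∈ Icc 0 (2 * Real.pi)) :
    HasSum (fun k : ℕ => cosCoeff f (k + 1) * Real.cos ((k + 1 : ℕ) * t)
      + sinCoeff f (k + 1) * Real.sin ((k + 1 : ℕ) * t)) (f t - cosCoeff f 0 / 2) := by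
  have : Fact (0 < 2 * Real.pi) := ⟨Real.two_pi_pos⟩
  -- the value at `2π` follows from the one at `0`, since both sides agree there
  wlog hlt : t < 2 * Real.pi generalizing t
  · obtain rfl : t = 2 * Real.pi := le_antisymm ht.2 (not_lt.1 hlt)
    have := this (t := 0) ⟨le_rfl, Real.two_pi_pos.le⟩ Real.two_pi_pos
    rw [h0] at this
    convert this using 3 with k
    · rw [mul_zero, Real.cos_zero, Real.cos_nat_mul_two_pi]
    · have : ((k + 1 : ℕ) : ℝ) * (2 * Real.pi) = ((2 * (k + 1) : ℕ) : ℝ) * Real.pi := by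
        push_cast; ring
      rw [mul_zero, Real.sin_zero, this, Real.sin_nat_mul_pi]
  let F : C(AddCircle (2 * Real.pi), ℂ) :=
    ⟨AddCircle.liftIco (2 * Real.pi) 0 (fun x => (f x : ℂ)),
      AddCircle.liftIco_zero_continuous (by simp only [h0])
        (Complex.continuous_ofReal.comp_continuousOn hf)⟩
  have hcoef : ∀ n : ℤ, fourierCoeff F n
      = fourierCoeffOn Real.two_pi_pos (fun x => (f x : ℂ)) n := by
    intro n
    simp only [F, ContinuousMap.coe_mk]
    rw [fourierCoeff_liftIco_eq]
    congr 1
    simp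
  have hcoefn : ∀ m : ℕ, fourierCoeff F m
      = ((cosCoeff f m : ℂ) - (sinCoeff f m : ℂ) * Complex.I) / 2 := fun m => by
    rw [hcoef, fourierCoeffOn_natCast hf]
  have hcoefneg : ∀ m : ℕ, fourierCoeff F (-(m : ℤ))
      = ((cosCoeff f m : ℂ) + (sinCoeff f m : ℂ) * Complex.I) / 2 := fun m => by
    rw [hcoef, fourierCoeffOn_neg_natCast hf]
  have hcC : Summable (fun m => (cosCoeff f m : ℂ)) := Complex.ofRealCLM.summable hc
  have hdC : Summable (fun m => (sinCoeff f m : ℂ)) := Complex.ofRealCLM.summable hd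
  have hsum : Summable (fourierCoeff F) := by
    refine Summable.of_nat_of_neg ?_ ?_
    · simp_rw [hcoefn]
      exact (hcC.sub (hdC.mul_right _)).div_const _
    · simp_rw [hcoefneg]
      exact (hcC.add (hdC.mul_right _)).div_const _
  have hS := has_pointwise_sum_fourier_series_of_summable hsum (t : AddCircle (2 * Real.pi))
  have hFt : F (t : AddCircle (2 * Real.pi)) = f t := by
    simp only [F, ContinuousMap.coe_mk]
    rw [AddCircle.liftIco_coe_apply]
    simpa using ⟨ht.1, hlt⟩
  rw [hFt] at hS
  have hN := hS.nat_add_neg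
  have hterm : ∀ m : ℕ, fourierCoeff F (m : ℤ) • fourier (m : ℤ) (t : AddCircle (2 * Real.pi))
      + fourierCoeff F (-(m : ℤ)) • fourier (-(m : ℤ)) (t : AddCircle (2 * Real.pi))
      = ((cosCoeff f m * Real.cos (m * t) + sinCoeff f m * Real.sin (m * t) : ℝ) : ℂ) := by
    intro m
    rw [hcoefn, hcoefneg, fourier_coe_apply, fourier_coe_apply]
    have e1 : 2 * (Real.pi : ℂ) * Complex.I * ((m : ℤ) : ℂ) * t / ((2 * Real.pi : ℝ) : ℂ)
        = ((m * t : ℝ) : ℂ) * Complex.I := by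
      push_cast; field_simp
    have e2 : 2 * (Real.pi : ℂ) * Complex.I * ((-(m : ℤ) : ℤ) : ℂ) * t / ((2 * Real.pi : ℝ) : ℂ)
        = ((-(m * t) : ℝ) : ℂ) * Complex.I := by
      push_cast; field_simp
    rw [e1, e2, Complex.exp_ofReal_mul_I, Complex.exp_ofReal_mul_I, Real.cos_neg, Real.sin_neg,
      smul_eq_mul, smul_eq_mul]
    push_cast
    linear_combination (-(sinCoeff f m : ℂ) * Complex.sin (m * t)) * Complex.I_sq
  simp_rw [hterm] at hN
  have h00 : fourierCoeff F 0 • fourier 0 (t : AddCircle (2 * Real.pi))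
      = ((cosCoeff f 0 / 2 : ℝ) : ℂ) := by
    have := hcoefn 0
    simp only [Nat.cast_zero] at this
    rw [this, fourier_zero]
    simp [sinCoeff]
  rw [h00, ← Complex.ofReal_add] at hN
  have hR := Complex.hasSum_ofReal.1 hN
  rw [← hasSum_nat_add_iff' 1] at hR
  have hval : f t + cosCoeff f 0 / 2 - ∑ i ∈ Finset.range 1,
      (cosCoeff f i * Real.cos (i * t) + sinCoeff f i * Real.sin (i * t))
      = f t - cosCoeff f 0 / 2 := by
    simp
    ring
  rwa [hval] at hR

/-! ### Liouville theorem in dimension at most two -/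

section Liouville

/-- The partial derivative `∂_i f (x)` on `ℝ^n`. -/
noncomputable def pderiv {n : ℕ} (i : Fin n) (f : EuclideanSpace ℝ (Fin n) → ℝ)
    (x : EuclideanSpace ℝ (Fin n)) : ℝ :=
  fderiv ℝ f x (EuclideanSpace.single i 1)

/-- The `i`-th component `∑_j b_{ij} ∂_j z` of the flux `B ∇z`. -/
noncomputable def flux {n : ℕ} (B : EuclideanSpace ℝ (Fin n) → Matrix (Fin n) (Fin n) ℝ)
    (z : EuclideanSpace ℝ (Fin n) → ℝ) (i : Fin n) (x : EuclideanSpace ℝ (Fin n)) : ℝ :=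
  ∑ j, B x i j * pderiv j z x

/-- The energy density `B ∇z · ∇z`. -/
noncomputable def energy {n : ℕ} (B : EuclideanSpace ℝ (Fin n) → Matrix (Fin n) (Fin n) ℝ)
    (z : EuclideanSpace ℝ (Fin n) → ℝ) (x : EuclideanSpace ℝ (Fin n)) : ℝ :=
  ∑ i, pderiv i z x * flux B z i x

section PointwiseAlgebra

open Matrix

/-- Young's inequality for the inner product given by a positive semidefinite matrix. -/
theorem young_of_posSemidef {n : ℕ} {M : Matrix (Fin n) (Fin n) ℝ} (hM : M.IsSymm)
    (hpos : ∀ ξ : Fin n → ℝ, 0 ≤ ξ ⬝ᵥ M *ᵥ ξ) (p e : Fin n → ℝ) (s z : ℝ) {l : ℝ} (hl : 0 < l) :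
    -(2 * s * z * (e ⬝ᵥ M *ᵥ p)) ≤ l * (s ^ 2 * (p ⬝ᵥ M *ᵥ p)) + l⁻¹ * (z ^ 2 * (e ⬝ᵥ M *ᵥ e)) := by
  have h := hpos ((l * s) • p + z • e)
  have hsymm : p ⬝ᵥ M *ᵥ e = e ⬝ᵥ M *ᵥ p := by
    rw [dotProduct_mulVec, ← mulVec_transpose, hM.eq, dotProduct_comm]
  simp only [mulVec_add, mulVec_smul, dotProduct_add, add_dotProduct, dotProduct_smul,
    smul_dotProduct, smul_eq_mul, hsymm] at h
  have h2 : 0 ≤ l * (s ^ 2 * (p ⬝ᵥ M *ᵥ p)) + 2 * s * z * (e ⬝ᵥ M *ᵥ p)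
      + l⁻¹ * (z ^ 2 * (e ⬝ᵥ M *ᵥ e)) :=
    (mul_nonneg (inv_pos.2 hl).le h).trans_eq (by field_simp; ring)
  linarith

end PointwiseAlgebra

namespace IsAdmissible

variable {n : ℕ} {B : EuclideanSpace ℝ (Fin n) → Matrix (Fin n) (Fin n) ℝ}

theorem dotProduct_mulVec_eq (x : EuclideanSpace ℝ (Fin n)) (ξ ζ : Fin n → ℝ) :
    dotProduct ξ (Matrix.mulVec (B x) ζ) = ∑ i, ∑ j, B x i j * ξ i * ζ j := by
  simp only [dotProduct, Matrix.mulVec, Finset.mul_sum]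
  exact Finset.sum_congr rfl fun i _ => Finset.sum_congr rfl fun j _ => by ring

theorem nonneg (hB : IsAdmissible B) (x : EuclideanSpace ℝ (Fin n)) (ξ : Fin n → ℝ) :
    0 ≤ dotProduct ξ (Matrix.mulVec (B x) ξ) := by
  rw [dotProduct_mulVec_eq]
  by_cases h : ξ = 0
  · simp [h]
  · exact (hB.pos x ξ h).le

/-- The quadratic form of a bounded matrix field is bounded on differentials of norm `1`. -/
theorem exists_quadratic_le (hB : IsAdmissible B) : ∃ C : ℝ, 0 ≤ C ∧
    ∀ x (L : EuclideanSpace ℝ (Fin n) →L[ℝ] ℝ),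
      dotProduct (fun i => L (EuclideanSpace.single i 1))
        (Matrix.mulVec (B x) (fun i => L (EuclideanSpace.single i 1))) ≤ C * ‖L‖ ^ 2 := by
  choose K hK using hB.bounded
  have hK0 : ∀ i j, 0 ≤ K i j := fun i j => (abs_nonneg _).trans (hK i j 0)
  refine ⟨∑ i, ∑ j, K i j, Finset.sum_nonneg fun i _ => Finset.sum_nonneg fun j _ => hK0 i j, ?_⟩
  intro x L
  have hL : ∀ i : Fin n, |L (EuclideanSpace.single i 1)| ≤ ‖L‖ := fun i => by
    simpa using L.le_opNorm (EuclideanSpace.single i (1 : ℝ))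
  rw [dotProduct_mulVec_eq, Finset.sum_mul]
  refine Finset.sum_le_sum fun i _ => ?_
  rw [Finset.sum_mul]
  refine Finset.sum_le_sum fun j _ => (le_abs_self _).trans ?_
  rw [abs_mul, abs_mul, mul_assoc, sq]
  exact mul_le_mul (hK i j x) (mul_le_mul (hL i) (hL j) (abs_nonneg _) (norm_nonneg _))
    (by positivity) (hK0 i j)

theorem energy_eq (z : EuclideanSpace ℝ (Fin n) → ℝ) (x : EuclideanSpace ℝ (Fin n)) :
    energy B z x =
      dotProduct (fun i => pderiv i z x) (Matrix.mulVec (B x) fun i => pderiv i z x) := rfl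

theorem energy_nonneg (hB : IsAdmissible B) (z : EuclideanSpace ℝ (Fin n) → ℝ)
    (x : EuclideanSpace ℝ (Fin n)) : 0 ≤ energy B z x := hB.nonneg x _

theorem fderiv_eq_zero_of_energy (hB : IsAdmissible B) {z : EuclideanSpace ℝ (Fin n) → ℝ}
    {x : EuclideanSpace ℝ (Fin n)} (h : energy B z x = 0) : fderiv ℝ z x = 0 := by
  have h0 : (fun i => pderiv i z x) = 0 := by
    by_contra hne
    have := hB.pos x _ hne
    rw [← dotProduct_mulVec_eq, ← energy_eq] at this
    exact this.ne' h
  refine ContinuousLinearMap.coe_injective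
    ((EuclideanSpace.basisFun (Fin n) ℝ).toBasis.ext fun i => ?_)
  simpa [pderiv] using congrFun h0 i

end IsAdmissible

open MeasureTheory in
/-- The divergence theorem for compactly supported fields. -/
theorem integral_fderiv_apply_eq_zero {n : ℕ} {F : EuclideanSpace ℝ (Fin n) → ℝ}
    (hF : ContDiff ℝ 1 F) (hs : HasCompactSupport F) (v : EuclideanSpace ℝ (Fin n)) :
    ∫ x, fderiv ℝ F x v = 0 := by
  have h := integral_mul_fderiv_eq_neg_fderiv_mul_of_integrable (μ := volume)
    (f := fun _ : EuclideanSpace ℝ (Fin n) => (1 : ℝ)) (g := F) (v := v) (by simp)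
    (by
      simp only [one_mul]
      exact ((hF.continuous_fderiv (by norm_num)).clm_apply
        continuous_const).integrable_of_hasCompactSupport (hs.fderiv_apply ℝ v))
    (by
      simp only [one_mul]
      exact hF.continuous.integrable_of_hasCompactSupport hs)
    (fun _ _ => differentiableAt_const _)
    (fun x _ => (hF.differentiable (by norm_num)) x)
  simpa using h

variable {n : ℕ} {B : EuclideanSpace ℝ (Fin n) → Matrix (Fin n) (Fin n) ℝ}

theorem continuous_energy {z : EuclideanSpace ℝ (Fin n) → ℝ} (hz : ContDiff ℝ 1 z)
    (hP : ∀ i, ContDiff ℝ 1 (flux B z i)) : Continuous (energy B z) := by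
  refine continuous_finsetSum _ fun i _ => Continuous.mul ?_ (hP i).continuous
  exact (hz.continuous_fderiv (by norm_num)).clm_apply continuous_const

theorem hasCompactSupport_sq_mul {η : EuclideanSpace ℝ (Fin n) → ℝ} (hη : HasCompactSupport η)
    (G : EuclideanSpace ℝ (Fin n) → ℝ) : HasCompactSupport (fun x => η x ^ 2 * G x) :=
  hη.mono fun x hx h0 => hx (by simp [h0])

open MeasureTheory in
/-- **Caccioppoli's inequality.** The weight `χ` only has to dominate `η²` where `∇η ≠ 0`, which
allows the energy on an annulus on the right-hand side. -/
theorem integral_energy_le (hB : IsAdmissible B) {C : ℝ}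
    (hC : ∀ x (L : EuclideanSpace ℝ (Fin n) →L[ℝ] ℝ),
      dotProduct (fun i => L (EuclideanSpace.single i 1))
        (Matrix.mulVec (B x) (fun i => L (EuclideanSpace.single i 1))) ≤ C * ‖L‖ ^ 2)
    {z : EuclideanSpace ℝ (Fin n) → ℝ} (hz : ContDiff ℝ 1 z)
    (hP : ∀ i, ContDiff ℝ 1 (flux B z i)) {K : ℝ} (hK : ∀ x, |z x| ≤ K)
    (hsub : ∀ x, 0 ≤ z x * ∑ i, pderiv i (flux B z i) x)
    {η χ : EuclideanSpace ℝ (Fin n) → ℝ} (hη : ContDiff ℝ 1 η) (hηs : HasCompactSupport η)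
    (hχ0 : ∀ x, 0 ≤ χ x) (hχ : ∀ x, fderiv ℝ η x ≠ 0 → η x ^ 2 ≤ χ x)
    (hint : Integrable (fun x => χ x * energy B z x)) {l : ℝ} (hl : 0 < l) :
    ∫ x, η x ^ 2 * energy B z x ≤
      l * (∫ x, χ x * energy B z x) + l⁻¹ * (K ^ 2 * C) * ∫ x, ‖fderiv ℝ η x‖ ^ 2 := by
  let F : Fin n → EuclideanSpace ℝ (Fin n) → ℝ := fun i x => η x ^ 2 * (z x * flux B z i x)
  have hF : ∀ i, ContDiff ℝ 1 (F i) := fun i => (hη.pow 2).mul (hz.mul (hP i))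
  have hFs : ∀ i, HasCompactSupport (F i) := fun i => hasCompactSupport_sq_mul hηs _
  have hDint : ∀ i, Integrable (pderiv i (F i)) := fun i =>
    (((hF i).continuous_fderiv (by norm_num)).clm_apply
        continuous_const).integrable_of_hasCompactSupport ((hFs i).fderiv_apply ℝ _)
  have hD0 : ∫ x, ∑ i, pderiv i (F i) x = 0 := by
    rw [integral_finsetSum _ fun i _ => hDint i]
    exact Finset.sum_eq_zero fun i _ => integral_fderiv_apply_eq_zero (hF i) (hFs i) _
  have hηd := hη.differentiable (by norm_num)
  have hzd := hz.differentiable (by norm_num)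
  have hEint : Integrable (fun x => η x ^ 2 * energy B z x) := by
    refine ((hη.continuous.pow 2).mul (continuous_energy hz hP)).integrable_of_hasCompactSupport ?_
    exact hasCompactSupport_sq_mul hηs _
  have hNint : Integrable (fun x => ‖fderiv ℝ η x‖ ^ 2) := by
    refine Continuous.integrable_of_hasCompactSupport
      ((hη.continuous_fderiv (by norm_num)).norm.pow 2) ?_
    exact (hηs.fderiv ℝ).mono fun x hx h0 => hx (by simp [h0])
  have hDsum : Integrable (fun x => ∑ i, pderiv i (F i) x) :=
    integrable_finsetSum _ fun i _ => hDint i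
  -- the product rule for `div (η² z B∇z)`
  have hprod : ∀ x, ∑ i, pderiv i (F i) x = η x ^ 2 * energy B z x
      + 2 * η x * z x * (∑ i, pderiv i η x * flux B z i x)
      + η x ^ 2 * (z x * ∑ i, pderiv i (flux B z i) x) := by
    intro x
    simp only [energy, Finset.mul_sum, ← Finset.sum_add_distrib]
    refine Finset.sum_congr rfl fun i _ => ?_
    have h1 := ((hηd x).hasFDerivAt.pow 2).mul
      ((hzd x).hasFDerivAt.mul (((hP i).differentiable (by norm_num)) x).hasFDerivAt)
    have h2 : fderiv ℝ (F i) x = _ := h1.fderiv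
    simp only [pderiv, h2]
    simp
    ring
  have hpt : ∀ x, η x ^ 2 * energy B z x ≤ ∑ i, pderiv i (F i) x
      + l * (χ x * energy B z x) + l⁻¹ * (K ^ 2 * C) * ‖fderiv ℝ η x‖ ^ 2 := by
    intro x
    have hE := hB.energy_nonneg z x
    have hl' := inv_pos.2 hl
    have hzG : 0 ≤ η x ^ 2 * (z x * ∑ i, pderiv i (flux B z i) x) :=
      mul_nonneg (sq_nonneg _) (hsub x)
    have hχE : 0 ≤ l * (χ x * energy B z x) := mul_nonneg hl.le (mul_nonneg (hχ0 x) hE)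
    rw [hprod x]
    by_cases h0 : fderiv ℝ η x = 0
    · have : ∑ i, pderiv i η x * flux B z i x = 0 := by simp [pderiv, h0]
      rw [this, h0]
      simp only [norm_zero]
      nlinarith
    · have hy := young_of_posSemidef (hB.symm x) (hB.nonneg x) (fun i => pderiv i z x)
        (fun i => pderiv i η x) (η x) (z x) hl
      have hq := hC x (fderiv ℝ η x)
      have hq0 := hB.nonneg x (fun i => pderiv i η x)
      rw [← IsAdmissible.energy_eq] at hy
      have hsum : dotProduct (fun i => pderiv i η x)
          (Matrix.mulVec (B x) fun i => pderiv i z x) = ∑ i, pderiv i η x * flux B z i x := rfl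
      rw [hsum] at hy
      have h3 : l * (η x ^ 2 * energy B z x) ≤ l * (χ x * energy B z x) := by
        gcongr
        exact hχ x h0
      have hz2 : z x ^ 2 ≤ K ^ 2 := sq_le_sq' (by linarith [abs_le.1 (hK x)]) (abs_le.1 (hK x)).2
      have h4 : l⁻¹ * (z x ^ 2 * dotProduct (fun i => pderiv i η x)
          (Matrix.mulVec (B x) fun i => pderiv i η x))
          ≤ l⁻¹ * (K ^ 2 * C) * ‖fderiv ℝ η x‖ ^ 2 := by
        rw [mul_assoc, mul_assoc]
        refine mul_le_mul_of_nonneg_left ?_ hl'.le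
        exact mul_le_mul hz2 hq hq0 (sq_nonneg _)
      linarith
  calc ∫ x, η x ^ 2 * energy B z x
      ≤ ∫ x, (∑ i, pderiv i (F i) x + l * (χ x * energy B z x)
          + l⁻¹ * (K ^ 2 * C) * ‖fderiv ℝ η x‖ ^ 2) :=
        integral_mono hEint ((hDsum.add (hint.const_mul l)).add (hNint.const_mul _)) hpt
    _ = _ := by
        have hDl : Integrable (fun x => ∑ i, pderiv i (F i) x + l * (χ x * energy B z x)) :=
          hDsum.add (hint.const_mul l)
        rw [integral_add hDl (hNint.const_mul _),
          integral_add hDsum (hint.const_mul l), hD0, integral_const_mul, integral_const_mul,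
          zero_add]

/-- A bounded increasing sequence with `a_k ≤ l (a_{k+1} - a_k) + D / l` for every `l > 0`
vanishes. -/
theorem eq_zero_of_le_mul_sub_add {a : ℕ → ℝ} {D M : ℝ} (h0 : ∀ k, 0 ≤ a k) (hmono : Monotone a)
    (hM : ∀ k, a k ≤ M) (h : ∀ l : ℝ, 0 < l → ∀ k, a k ≤ l * (a (k + 1) - a k) + l⁻¹ * D) (k : ℕ) :
    a k = 0 := by
  obtain ⟨A, hA⟩ : ∃ A, Filter.Tendsto a Filter.atTop (nhds A) :=
    ⟨_, tendsto_atTop_ciSup hmono ⟨M, by rintro _ ⟨k, rfl⟩; exact hM k⟩⟩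
  have hA' := (Filter.tendsto_add_atTop_iff_nat 1).2 hA
  have h1 : ∀ l : ℝ, 0 < l → A ≤ l⁻¹ * D := fun l hl => by
    have := le_of_tendsto_of_tendsto' hA (((hA'.sub hA).const_mul l).add_const (l⁻¹ * D)) (h l hl)
    simpa using this
  have h2 : A ≤ 0 := by
    have ht : Filter.Tendsto (fun l : ℝ => l⁻¹ * D) Filter.atTop (nhds (0 * D)) :=
      tendsto_inv_atTop_zero.mul_const D
    rw [zero_mul] at ht
    exact ge_of_tendsto ht ((Filter.eventually_gt_atTop 0).mono h1)
  exact le_antisymm ((hmono.ge_of_tendsto hA k).trans h2) (h0 k)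

open MeasureTheory in
/-- The cutoff functions behind parabolicity: in dimension at most `2` there is, for every `R ≥ 1`,
a cutoff of the ball of radius `R` inside the ball of radius `2R` with Dirichlet energy bounded
independently of `R`. -/
theorem exists_cutoff (hn : n ≤ 2) : ∃ D : ℝ, 0 ≤ D ∧ ∀ R : ℝ, 1 ≤ R →
    ∃ η : EuclideanSpace ℝ (Fin n) → ℝ, ContDiff ℝ 1 η ∧ HasCompactSupport η ∧
      (∀ x, 0 ≤ η x ∧ η x ≤ 1) ∧ (∀ x, ‖x‖ ≤ R → η x = 1) ∧ (∀ x, 2 * R ≤ ‖x‖ → η x = 0) ∧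
      ∫ x, ‖fderiv ℝ η x‖ ^ 2 ≤ D := by
  let b : ContDiffBump (0 : EuclideanSpace ℝ (Fin n)) := ⟨1, 2, one_pos, one_lt_two⟩
  have hbd : ContDiff ℝ 1 b := b.contDiff
  refine ⟨∫ x, ‖fderiv ℝ b x‖ ^ 2, integral_nonneg fun x => by positivity, fun R hR => ?_⟩
  have hR0 : 0 < R := by linarith
  have hnorm : ∀ x : EuclideanSpace ℝ (Fin n), ‖R⁻¹ • x‖ = R⁻¹ * ‖x‖ := fun x => by
    rw [norm_smul, Real.norm_of_nonneg (inv_pos.2 hR0).le]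
  refine ⟨fun x => b (R⁻¹ • x), hbd.comp (contDiff_const_smul _),
    b.hasCompactSupport.comp_smul (inv_ne_zero hR0.ne'), fun x => ⟨b.nonneg, b.le_one⟩,
    fun x hx => b.one_of_mem_closedBall ?_, fun x hx => b.zero_of_le_dist ?_, ?_⟩
  · rw [mem_closedBall_zero_iff, hnorm, inv_mul_le_iff₀ hR0]
    simpa [b] using hx
  · rw [dist_zero_right, hnorm, le_inv_mul_iff₀ hR0]
    simpa [b, mul_comm] using hx
  · have hfd : ∀ x : EuclideanSpace ℝ (Fin n), ‖fderiv ℝ (fun y => b (R⁻¹ • y)) x‖ ^ 2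
        = (R⁻¹) ^ 2 * (fun y => ‖fderiv ℝ b y‖ ^ 2) (R⁻¹ • x) := fun x => by
      rw [fderiv_comp_smul, norm_smul, mul_pow, Real.norm_of_nonneg (inv_pos.2 hR0).le]
    rw [integral_congr_ae (.of_forall hfd), integral_const_mul,
      Measure.integral_comp_inv_smul (μ := volume) (fun y => ‖fderiv ℝ b y‖ ^ 2),
      finrank_euclideanSpace_fin, smul_eq_mul, ← mul_assoc, abs_of_pos (pow_pos hR0 n)]
    refine mul_le_of_le_one_left (integral_nonneg fun x => by positivity) ?_
    rw [inv_pow, inv_mul_le_iff₀ (by positivity), mul_one]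
    exact pow_le_pow_right₀ hR hn

open MeasureTheory Metric in
/-- **Liouville's theorem** in dimension at most `2`: a bounded `z` with `z div (B ∇z) ≥ 0`
is constant. With `z ≥ 0` this applies to subsolutions. -/
theorem fderiv_eq_zero_of_bounded (hn : n ≤ 2) (hB : IsAdmissible B)
    {z : EuclideanSpace ℝ (Fin n) → ℝ} (hz : ContDiff ℝ 1 z)
    (hP : ∀ i, ContDiff ℝ 1 (flux B z i)) {K : ℝ} (hK : ∀ x, |z x| ≤ K)
    (hsub : ∀ x, 0 ≤ z x * ∑ i, pderiv i (flux B z i) x) (x : EuclideanSpace ℝ (Fin n)) :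
    fderiv ℝ z x = 0 := by
  obtain ⟨C, hC0, hC⟩ := hB.exists_quadratic_le
  obtain ⟨D, hD0, hD⟩ := exists_cutoff hn
  have hEc := continuous_energy hz hP
  have hE0 := hB.energy_nonneg z
  let S : ℕ → Set (EuclideanSpace ℝ (Fin n)) := fun k => closedBall 0 (2 ^ k)
  let a : ℕ → ℝ := fun k => ∫ x in S k, energy B z x
  have hS : ∀ k, MeasurableSet (S k) := fun k => isClosed_closedBall.measurableSet
  have hSi : ∀ k, IntegrableOn (energy B z) (S k) := fun k =>
    hEc.continuousOn.integrableOn_compact (isCompact_closedBall _ _)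
  have hSm : Monotone S := fun i j hij => closedBall_subset_closedBall
    (pow_le_pow_right₀ one_le_two hij)
  have ha0 : ∀ k, 0 ≤ a k := fun k => setIntegral_nonneg (hS k) fun x _ => hE0 x
  have ham : Monotone a := fun i j hij => setIntegral_mono_set (hSi j)
    (.of_forall hE0) (LE.le.eventuallyLE (hSm hij))
  have hind : ∀ k, ∀ x, (S k).indicator (1 : EuclideanSpace ℝ (Fin n) → ℝ) x * energy B z x
      = (S k).indicator (energy B z) x := fun k x => by
    by_cases h : x ∈ S k <;> simp [h]
  have hindi : ∀ k, Integrable (fun x =>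
      (S k).indicator (1 : EuclideanSpace ℝ (Fin n) → ℝ) x * energy B z x) := fun k => by
    simp_rw [hind]
    exact (hSi k).integrable_indicator (hS k)
  have hinda : ∀ k, ∫ x, (S k).indicator (1 : EuclideanSpace ℝ (Fin n) → ℝ) x * energy B z x
      = a k := fun k => by
    simp_rw [hind]
    exact integral_indicator (hS k)
  -- the energy on a ball is controlled by that on any cutoff of it
  have hle : ∀ k, ∀ η : EuclideanSpace ℝ (Fin n) → ℝ, ContDiff ℝ 1 η → HasCompactSupport η →
      (∀ x, ‖x‖ ≤ 2 ^ k → η x = 1) → Integrable (fun x => η x ^ 2 * energy B z x) ∧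
        a k ≤ ∫ x, η x ^ 2 * energy B z x := by
    intro k η h1 h2 h3
    have hi : Integrable (fun x => η x ^ 2 * energy B z x) := by
      refine ((h1.continuous.pow 2).mul hEc).integrable_of_hasCompactSupport ?_
      exact hasCompactSupport_sq_mul h2 _
    refine ⟨hi, ?_⟩
    rw [← hinda]
    refine integral_mono (hindi k) hi fun x => ?_
    refine mul_le_mul_of_nonneg_right ?_ (hE0 x)
    by_cases h : x ∈ S k
    · simp [h, h3 x (by simpa [S] using h)]
    · simp [h, sq_nonneg]
  have hcut := fun k : ℕ => hD (2 ^ k) (one_le_pow₀ one_le_two)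
  have hKC : 0 ≤ K ^ 2 * C := by positivity
  have hbound : ∀ k, a k ≤ 4 * (K ^ 2 * C * D) := by
    intro k
    obtain ⟨η, h1, h2, h3, h4, h5, h6⟩ := hcut k
    obtain ⟨hi, hk⟩ := hle k η h1 h2 h4
    have h := integral_energy_le hB hC hz hP hK hsub h1 h2 (fun x => sq_nonneg (η x))
      (fun x _ => le_rfl) hi (l := 1 / 2) (by norm_num)
    have h7 := mul_le_mul_of_nonneg_left h6 hKC
    norm_num at h
    nlinarith
  have hstep : ∀ l : ℝ, 0 < l → ∀ k, a k ≤ l * (a (k + 1) - a k) + l⁻¹ * (K ^ 2 * C * D) := by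
    intro l hl k
    obtain ⟨η, h1, h2, h3, h4, h5, h6⟩ := hcut k
    obtain ⟨hi, hk⟩ := hle k η h1 h2 h4
    let χ : EuclideanSpace ℝ (Fin n) → ℝ := fun x =>
      (S (k + 1)).indicator 1 x - (S k).indicator 1 x
    have hχe : ∀ x, χ x * energy B z x
        = (S (k + 1)).indicator (1 : EuclideanSpace ℝ (Fin n) → ℝ) x * energy B z x
          - (S k).indicator (1 : EuclideanSpace ℝ (Fin n) → ℝ) x * energy B z x :=
      fun x => sub_mul _ _ _
    have hχi : Integrable (fun x => χ x * energy B z x) := by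
      simp_rw [hχe]
      exact (hindi _).sub (hindi _)
    have hχa : ∫ x, χ x * energy B z x = a (k + 1) - a k := by
      simp_rw [hχe]
      rw [integral_sub (hindi _) (hindi _), hinda, hinda]
    have hχ0 : ∀ x, 0 ≤ χ x := fun x => sub_nonneg.2
      (indicator_le_indicator_of_subset (hSm k.le_succ) (fun _ => zero_le_one) x)
    have hχ1 : ∀ x, fderiv ℝ η x ≠ 0 → η x ^ 2 ≤ χ x := by
      intro x hx
      -- the cutoff is extremal, hence critical, off the open annulus
      have hx1 : x ∉ S k := fun h => hx <| IsLocalMax.fderiv_eq_zero <| .of_forall fun y => by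
        rw [h4 x (by simpa [S] using h)]; exact (h3 y).2
      have hx2 : x ∈ S (k + 1) := by
        by_contra h
        refine hx <| IsLocalMin.fderiv_eq_zero <| .of_forall fun y => ?_
        rw [h5 x (by simp only [S, mem_closedBall_zero_iff, not_le, pow_succ] at h; linarith)]
        exact (h3 y).1
      have : χ x = 1 := by simp [χ, hx1, hx2]
      rw [this]
      exact pow_le_one₀ (h3 x).1 (h3 x).2
    have h := integral_energy_le hB hC hz hP hK hsub h1 h2 hχ0 hχ1 hχi hl
    rw [hχa] at h
    have h7 := mul_le_mul_of_nonneg_left h6 (mul_nonneg (inv_pos.2 hl).le hKC)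
    calc a k ≤ _ := hk.trans h
      _ ≤ _ := by linarith
  have ha := eq_zero_of_le_mul_sub_add ha0 ham hbound hstep
  refine hB.fderiv_eq_zero_of_energy ?_
  obtain ⟨k, hk⟩ := pow_unbounded_of_one_lt ‖x‖ (one_lt_two : (1 : ℝ) < 2)
  have hae : energy B z =ᵐ[volume.restrict (S k)] 0 :=
    (setIntegral_eq_zero_iff_of_nonneg_ae (.of_forall hE0) (hSi k)).1 (ha k)
  have hae' : energy B z =ᵐ[volume.restrict (ball 0 (2 ^ k))] 0 :=
    ae_mono (Measure.restrict_mono ball_subset_closedBall le_rfl) hae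
  exact Measure.eqOn_open_of_ae_eq hae' isOpen_ball hEc.continuousOn continuousOn_const
    (mem_ball_zero_iff.2 hk)

theorem flux_add_const (z : EuclideanSpace ℝ (Fin n) → ℝ) (c : ℝ) (i : Fin n) :
    flux B (fun x => z x + c) i = flux B z i := by
  ext x
  simp [flux, pderiv]

theorem eq_of_fderiv_eq_zero {z : EuclideanSpace ℝ (Fin n) → ℝ} (hz : ContDiff ℝ 1 z)
    (h : ∀ x, fderiv ℝ z x = 0) (x y : EuclideanSpace ℝ (Fin n)) : z x = z y :=
  is_const_of_fderiv_eq_zero (hz.differentiable (by norm_num)) h x y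

/-- A constant function has zero flux divergence. -/
theorem div_flux_eq_zero {z : EuclideanSpace ℝ (Fin n) → ℝ} (h : ∀ x, fderiv ℝ z x = 0)
    (x : EuclideanSpace ℝ (Fin n)) : ∑ i, pderiv i (flux B z i) x = 0 := by
  have : ∀ i, flux B z i = fun _ => 0 := fun i => by
    ext y
    simp [flux, pderiv, h]
  simp [this, pderiv]

/-- Bounded subsolutions of `div (B ∇w) ≥ 0` are constant in dimension at most `2`. -/
theorem fderiv_eq_zero_of_subsolution (hn : n ≤ 2) (hB : IsAdmissible B)
    {w : EuclideanSpace ℝ (Fin n) → ℝ} (hw : ContDiff ℝ 1 w)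
    (hP : ∀ i, ContDiff ℝ 1 (flux B w i)) {K : ℝ} (hK : ∀ x, |w x| ≤ K)
    (hsub : ∀ x, 0 ≤ ∑ i, pderiv i (flux B w i) x) (x : EuclideanSpace ℝ (Fin n)) :
    fderiv ℝ w x = 0 := by
  have h := fderiv_eq_zero_of_bounded hn hB (z := fun x => w x + K) (hw.add contDiff_const)
    (fun i => by rw [flux_add_const]; exact hP i) (K := K + K)
    (fun x => (abs_add_le _ _).trans (add_le_add (hK x)
      (abs_of_nonneg ((abs_nonneg _).trans (hK x))).le))
    (fun x => by
      simp_rw [flux_add_const]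
      exact mul_nonneg (by linarith [(abs_le.1 (hK x)).1]) (hsub x)) x
  simpa using h

/-- Bounded solutions of `div (B ∇w) = k w + c` with `k > 0` are constant. -/
theorem eq_zero_of_screened (hn : n ≤ 2) (hB : IsAdmissible B)
    {w : EuclideanSpace ℝ (Fin n) → ℝ} (hw : ContDiff ℝ 1 w)
    (hP : ∀ i, ContDiff ℝ 1 (flux B w i)) {K : ℝ} (hK : ∀ x, |w x| ≤ K) {k c : ℝ} (hk : 0 < k)
    (heq : ∀ x, ∑ i, pderiv i (flux B w i) x = k * w x + c) (x : EuclideanSpace ℝ (Fin n)) :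
    k * w x + c = 0 := by
  have h := fderiv_eq_zero_of_bounded hn hB (z := fun x => w x + c / k) (hw.add contDiff_const)
    (fun i => by rw [flux_add_const]; exact hP i) (K := K + |c / k|)
    (fun x => (abs_add_le _ _).trans (add_le_add (hK x) le_rfl))
    (fun x => by
      simp_rw [flux_add_const]
      rw [heq x, show k * w x + c = k * (w x + c / k) by field_simp]
      nlinarith [mul_nonneg hk.le (mul_self_nonneg (w x + c / k))])
  have h' : ∀ x, fderiv ℝ w x = 0 := fun x => by simpa using h x
  rw [← heq x, div_flux_eq_zero h']

end Liouville

/-! ### Vertical modes of half space functions -/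

section Modes

/-- The closed upper half space. -/
def halfSpace (n : ℕ) : Set (Pt n) := {x | 0 ≤ x.2}

variable {n : ℕ}

theorem uniqueDiffOn_halfSpace : UniqueDiffOn ℝ (halfSpace n) := by
  have : halfSpace n = (univ : Set (EuclideanSpace ℝ (Fin n))) ×ˢ Ici (0 : ℝ) := by
    ext x; simp [halfSpace]
  rw [this]
  exact uniqueDiffOn_univ.prod (uniqueDiffOn_Ici 0)

theorem halfSpace_mem_nhds {x : Pt n} (hx : 0 < x.2) : halfSpace n ∈ nhds x :=
  Filter.mem_of_superset ((isOpen_lt continuous_const continuous_snd).mem_nhds hx)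
    fun y (hy : 0 < y.2) => show 0 ≤ y.2 from hy.le

/-- The derivative of `F` in the direction `v`, one-sided on the boundary of the half space. -/
noncomputable def wderiv (F : Pt n → ℝ) (v : Pt n) (x : Pt n) : ℝ :=
  fderivWithin ℝ F (halfSpace n) x v

theorem ContDiffOn.wderiv {F : Pt n → ℝ} (hF : ContDiffOn ℝ 2 F (halfSpace n)) (v : Pt n) :
    ContDiffOn ℝ 1 (wderiv F v) (halfSpace n) :=
  (hF.fderivWithin uniqueDiffOn_halfSpace (by norm_num)).clm_apply contDiffOn_const

theorem ContDiffOn.continuousOn_wderiv {F : Pt n → ℝ} (hF : ContDiffOn ℝ 1 F (halfSpace n))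
    (v : Pt n) : ContinuousOn (_root_.wderiv F v) (halfSpace n) :=
  (hF.continuousOn_fderivWithin uniqueDiffOn_halfSpace (by norm_num)).clm_apply continuousOn_const

theorem ContDiffOn.hasFDerivAt_horizontal {F : Pt n → ℝ} (hF : ContDiffOn ℝ 1 F (halfSpace n))
    (x : EuclideanSpace ℝ (Fin n)) {t : ℝ} (ht : 0 ≤ t) :
    HasFDerivAt (fun y => F (y, t)) ((fderivWithin ℝ F (halfSpace n) (x, t)).comp
      (ContinuousLinearMap.inl ℝ (EuclideanSpace ℝ (Fin n)) ℝ)) x := by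
  have h1 := ((hF.differentiableOn (by norm_num)) (x, t) ht).hasFDerivWithinAt
  exact hasFDerivWithinAt_univ.1
    (h1.comp x (hasFDerivAt_prodMk_left x t).hasFDerivWithinAt fun y _ => ht)

theorem ContDiffOn.hasDerivWithinAt_vertical {F : Pt n → ℝ}
    (hF : ContDiffOn ℝ 1 F (halfSpace n)) (x : EuclideanSpace ℝ (Fin n)) {t : ℝ} (ht : 0 ≤ t) :
    HasDerivWithinAt (fun s => F (x, s)) (_root_.wderiv F (0, 1) (x, t)) (Ici 0) t := by
  have h1 := ((hF.differentiableOn (by norm_num)) (x, t) ht).hasFDerivWithinAt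
  have h2 : HasDerivWithinAt (fun s => F (x, s)) _ (Ici 0) t :=
    (h1.comp t (hasFDerivAt_prodMk_right x t).hasFDerivWithinAt (s := Ici 0)
    fun y hy => hy).hasDerivWithinAt
  exact h2.congr_deriv (by simp [_root_.wderiv])

theorem ContDiffOn.hasDerivAt_vertical {F : Pt n → ℝ}
    (hF : ContDiffOn ℝ 1 F (halfSpace n)) (x : EuclideanSpace ℝ (Fin n)) {t : ℝ} (ht : 0 < t) :
    HasDerivAt (fun s => F (x, s)) (_root_.wderiv F (0, 1) (x, t)) t :=
  (hF.hasDerivWithinAt_vertical x ht.le).hasDerivAt (Ici_mem_nhds ht)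

theorem continuousOn_slice {F : Pt n → ℝ} (hF : ContinuousOn F (halfSpace n))
    (x : EuclideanSpace ℝ (Fin n)) {T : ℝ} : ContinuousOn (fun t => F (x, t)) (Icc 0 T) :=
  hF.comp (by fun_prop) fun _ ht => ht.1

theorem intervalIntegrable_slice {F : Pt n → ℝ} (hF : ContinuousOn F (halfSpace n))
    (x : EuclideanSpace ℝ (Fin n)) {T : ℝ} (hT : 0 ≤ T) {φ : ℝ → ℝ} (hφ : Continuous φ) :
    IntervalIntegrable (fun t => F (x, t) * φ t) MeasureTheory.volume 0 T := by
  apply ContinuousOn.intervalIntegrable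
  rw [uIcc_of_le hT]
  exact (continuousOn_slice hF x).mul hφ.continuousOn

open MeasureTheory in
/-- Differentiation under the integral sign over a vertical segment, up to the boundary. -/
theorem contDiff_integral_slice {F : Pt n → ℝ} (hF : ContDiffOn ℝ 1 F (halfSpace n)) {T : ℝ}
    (hT : 0 ≤ T) {φ : ℝ → ℝ} (hφ : Continuous φ) :
    ContDiff ℝ 1 (fun x => ∫ t in (0 : ℝ)..T, F (x, t) * φ t) ∧
    ∀ i x, pderiv i (fun x => ∫ t in (0 : ℝ)..T, F (x, t) * φ t) x =
      ∫ t in (0 : ℝ)..T, wderiv F (EuclideanSpace.single i 1, 0) (x, t) * φ t := by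
  -- replacing `t` by `max t 0` makes the derivative continuous on the whole space, without
  -- changing it on the segment
  let L : EuclideanSpace ℝ (Fin n) → ℝ → EuclideanSpace ℝ (Fin n) →L[ℝ] ℝ := fun x t =>
    φ t • (fderivWithin ℝ F (halfSpace n) (x, max t 0)).comp
      (ContinuousLinearMap.inl ℝ (EuclideanSpace ℝ (Fin n)) ℝ)
  have hLc : Continuous (Function.uncurry L) := by
    have h1 : Continuous fun p : EuclideanSpace ℝ (Fin n) × ℝ =>
        fderivWithin ℝ F (halfSpace n) (p.1, max p.2 0) :=
      (hF.continuousOn_fderivWithin uniqueDiffOn_halfSpace (by norm_num)).comp_continuous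
        (by fun_prop) fun p => show 0 ≤ max p.2 0 from le_max_right _ _
    exact (hφ.comp continuous_snd).smul (h1.clm_comp continuous_const)
  have hder : ∀ x, HasFDerivAt (fun x => ∫ t in (0 : ℝ)..T, F (x, t) * φ t)
      (∫ t in (0 : ℝ)..T, L x t) x := by
    intro x
    obtain ⟨C, hC⟩ := ((isCompact_closedBall x 1).prod (isCompact_Icc (a := 0) (b := T))
      ).exists_bound_of_continuousOn hLc.continuousOn
    refine intervalIntegral.hasFDerivAt_integral_of_dominated_of_fderiv_le
      (F := fun x t => F (x, t) * φ t) (F' := L) (bound := fun _ => C)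
      (Metric.closedBall_mem_nhds x one_pos)
      (.of_forall fun y => (intervalIntegrable_slice hF.continuousOn y hT hφ).def'.1)
      (intervalIntegrable_slice hF.continuousOn x hT hφ)
      (by fun_prop) (.of_forall fun t ht y hy => ?_) intervalIntegrable_const
      (.of_forall fun t ht y hy => ?_)
    · rw [uIoc_of_le hT] at ht
      exact hC (y, t) ⟨hy, ht.1.le, ht.2⟩
    · rw [uIoc_of_le hT] at ht
      simp only [L, max_eq_left ht.1.le]
      exact (hF.hasFDerivAt_horizontal y ht.1.le).mul_const (φ t)
  have hfd : fderiv ℝ (fun x => ∫ t in (0 : ℝ)..T, F (x, t) * φ t)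
      = fun x => ∫ t in (0 : ℝ)..T, L x t := funext fun x => (hder x).fderiv
  refine ⟨contDiff_one_iff_fderiv.2 ⟨fun x => (hder x).differentiableAt, ?_⟩, fun i x => ?_⟩
  · rw [hfd]
    exact intervalIntegral.continuous_parametric_intervalIntegral_of_continuous' hLc 0 T
  · have hLx : Continuous (L x) := hLc.comp (Continuous.prodMk_right x)
    rw [pderiv, hfd, ContinuousLinearMap.intervalIntegral_apply (hLx.intervalIntegrable 0 T)]
    refine intervalIntegral.integral_congr fun t ht => ?_
    rw [uIcc_of_le hT] at ht
    simp [L, wderiv, max_eq_left ht.1, mul_comm]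

/-- Green's formula on a vertical segment, against an eigenfunction `φ'' = -k φ`. -/
theorem integral_slice_eigenfunction {u : Pt n → ℝ} (hu : ContDiffOn ℝ 2 u (halfSpace n))
    {φ φ' : ℝ → ℝ} {k : ℝ} (hφ : ∀ t, HasDerivAt φ (φ' t) t)
    (hφ' : ∀ t, HasDerivAt φ' (-k * φ t) t) {T : ℝ} (hT : 0 ≤ T) (x : EuclideanSpace ℝ (Fin n)) :
    ∫ t in (0 : ℝ)..T, wderiv (wderiv u (0, 1)) (0, 1) (x, t) * φ t =
      (wderiv u (0, 1) (x, T) * φ T - u (x, T) * φ' T)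
      - (wderiv u (0, 1) (x, 0) * φ 0 - u (x, 0) * φ' 0)
      - k * ∫ t in (0 : ℝ)..T, u (x, t) * φ t := by
  have hu1 : ContDiffOn ℝ 1 u (halfSpace n) := hu.of_le (by norm_num)
  have hut := hu.wderiv (0, 1)
  have hφc : Continuous φ := continuous_iff_continuousAt.2 fun t => (hφ t).continuousAt
  have hφc' : Continuous φ' := continuous_iff_continuousAt.2 fun t => (hφ' t).continuousAt
  have hi1 := intervalIntegrable_slice (hut.continuousOn_wderiv (0, 1)) x hT hφc
  have hi2 := intervalIntegrable_slice hu1.continuousOn x hT hφc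
  have h := intervalIntegral.integral_eq_sub_of_hasDerivAt_of_le hT
    (f := fun t => wderiv u (0, 1) (x, t) * φ t - u (x, t) * φ' t)
    (f' := fun t => wderiv (wderiv u (0, 1)) (0, 1) (x, t) * φ t + k * (u (x, t) * φ t))
    (((continuousOn_slice hut.continuousOn x).mul hφc.continuousOn).sub
      ((continuousOn_slice hu1.continuousOn x).mul hφc'.continuousOn))
    (fun t ht => by
      have h1 := ((hut.hasDerivAt_vertical x ht.1).mul (hφ t)).sub
        ((hu1.hasDerivAt_vertical x ht.1).mul (hφ' t))
      refine h1.congr_deriv ?_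
      ring)
    (hi1.add (hi2.const_mul k))
  rw [intervalIntegral.integral_add hi1 (hi2.const_mul k), intervalIntegral.integral_const_mul] at h
  linarith

variable {B : EuclideanSpace ℝ (Fin n) → Matrix (Fin n) (Fin n) ℝ} {g : ℝ → ℝ} {u : Pt n → ℝ}

/-- The `i`-th horizontal component of `A ∇u`. -/
noncomputable def hflux (B : EuclideanSpace ℝ (Fin n) → Matrix (Fin n) (Fin n) ℝ) (u : Pt n → ℝ)
    (i : Fin n) (y : Pt n) : ℝ :=
  ∑ j, B y.1 i j * wderiv u (EuclideanSpace.single j 1, 0) y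

theorem contDiffOn_hflux (hB : IsAdmissible B) (hu : ContDiffOn ℝ 2 u (halfSpace n)) (i : Fin n) :
    ContDiffOn ℝ 1 (hflux B u i) (halfSpace n) :=
  ContDiffOn.sum fun j _ => ((hB.contDiff i j).comp contDiff_fst).contDiffOn.mul (hu.wderiv _)

theorem fderiv_eq_fderivWithin_halfSpace (F : Pt n → ℝ) {y : Pt n} (hy : 0 < y.2) :
    fderiv ℝ F y = fderivWithin ℝ F (halfSpace n) y :=
  (fderivWithin_of_mem_nhds (halfSpace_mem_nhds hy)).symm

/-- The equation with the horizontal and the vertical parts of the divergence separated. -/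
theorem IsHalfSpaceSolution.split_equation (hu : IsHalfSpaceSolution (blockMatrix B) g u)
    {y : Pt n} (hy : 0 < y.2) :
    ∑ i, wderiv (hflux B u i) (EuclideanSpace.single i 1, 0) y
      + wderiv (wderiv u (0, 1)) (0, 1) y = g y.2 - u y := by
  have hnhds : ∀ᶠ z : Pt n in nhds y, 0 < z.2 :=
    (isOpen_lt continuous_const continuous_snd).mem_nhds hy
  have h1 : ∀ i : Fin n, partialD (Sum.inl i)
      (fun y => ∑ j, blockMatrix B y (Sum.inl i) j * partialD j u y) y
      = wderiv (hflux B u i) (EuclideanSpace.single i 1, 0) y := by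
    intro i
    rw [partialD, wderiv, ← fderiv_eq_fderivWithin_halfSpace _ hy]
    congr 1
    refine Filter.EventuallyEq.fderiv_eq (hnhds.mono fun z hz => ?_)
    simp [hflux, blockMatrix, partialD, basisDir, wderiv, fderiv_eq_fderivWithin_halfSpace u hz]
  have h2 : partialD (Sum.inr ())
      (fun y => ∑ j, blockMatrix B y (Sum.inr ()) j * partialD j u y) y
      = wderiv (wderiv u (0, 1)) (0, 1) y := by
    rw [partialD, wderiv, ← fderiv_eq_fderivWithin_halfSpace _ hy]
    congr 1
    refine Filter.EventuallyEq.fderiv_eq (hnhds.mono fun z hz => ?_)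
    simp [blockMatrix, partialD, basisDir, wderiv, fderiv_eq_fderivWithin_halfSpace u hz]
  have h3 := hu.equation y hy
  rw [divForm, Fintype.sum_sum_type, Finset.univ_unique (α := Unit),
    Finset.sum_singleton, Finset.sum_congr rfl fun i _ => h1 i] at h3
  rw [PUnit.default_eq_unit, h2] at h3
  linarith

/-- The horizontal equation satisfied by the mode `w(x') = ∫ u(x', t) φ(t) dt`, when
`φ'' = -k φ`. -/
theorem IsHalfSpaceSolution.mode_equation (hB : IsAdmissible B) (hg : Continuous g)
    (hu : IsHalfSpaceSolution (blockMatrix B) g u)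
    {φ φ' : ℝ → ℝ} {k : ℝ} (hφ : ∀ t, HasDerivAt φ (φ' t) t)
    (hφ' : ∀ t, HasDerivAt φ' (-k * φ t) t) {T : ℝ} (hT : 0 ≤ T) :
    ContDiff ℝ 1 (fun x => ∫ t in (0 : ℝ)..T, u (x, t) * φ t) ∧
    (∀ i, ContDiff ℝ 1 (flux B (fun x => ∫ t in (0 : ℝ)..T, u (x, t) * φ t) i)) ∧
    ∀ x, ∑ i, pderiv i (flux B (fun x => ∫ t in (0 : ℝ)..T, u (x, t) * φ t) i) x =
      (k - 1) * (∫ t in (0 : ℝ)..T, u (x, t) * φ t) + (∫ t in (0 : ℝ)..T, g t * φ t)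
      - (wderiv u (0, 1) (x, T) * φ T - u (x, T) * φ' T) + wderiv u (0, 1) (x, 0) * φ 0 := by
  have hu2 : ContDiffOn ℝ 2 u (halfSpace n) := hu.contDiffOn
  have hu1 : ContDiffOn ℝ 1 u (halfSpace n) := hu2.of_le (by norm_num)
  have hφc : Continuous φ := continuous_iff_continuousAt.2 fun t => (hφ t).continuousAt
  obtain ⟨hw, hwd⟩ := contDiff_integral_slice hu1 hT hφc
  have hfl : ∀ i, flux B (fun x => ∫ t in (0 : ℝ)..T, u (x, t) * φ t) i
      = fun x => ∫ t in (0 : ℝ)..T, hflux B u i (x, t) * φ t := by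
    intro i
    ext x
    simp only [flux, hflux, hwd, Finset.sum_mul]
    rw [intervalIntegral.integral_finsetSum]
    · refine Finset.sum_congr rfl fun j _ => ?_
      rw [← intervalIntegral.integral_const_mul]
      simp only [mul_assoc]
    · intro j _
      simp only [mul_assoc]
      exact (intervalIntegrable_slice (hu2.wderiv _).continuousOn x hT hφc).const_mul _
  have hq := fun i => contDiff_integral_slice (contDiffOn_hflux hB hu2 i) hT hφc
  refine ⟨hw, fun i => by rw [hfl]; exact (hq i).1, fun x => ?_⟩
  have hi : ∀ i, IntervalIntegrable (fun t =>
      wderiv (hflux B u i) (EuclideanSpace.single i 1, 0) (x, t) * φ t)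
      MeasureTheory.volume 0 T := fun i =>
    intervalIntegrable_slice ((contDiffOn_hflux hB hu2 i).continuousOn_wderiv _) x hT hφc
  have hutt := intervalIntegrable_slice ((hu2.wderiv (0, 1)).continuousOn_wderiv (0, 1)) x hT hφc
  have hui := intervalIntegrable_slice hu1.continuousOn x hT hφc
  have hgi : IntervalIntegrable (fun t => g t * φ t) MeasureTheory.volume 0 T :=
    (hg.mul hφc).intervalIntegrable _ _
  have hgreen := integral_slice_eigenfunction hu2 hφ hφ' hT x
  rw [hu.boundary x, zero_mul, sub_zero] at hgreen
  simp_rw [hfl, (hq _).2]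
  rw [← intervalIntegral.integral_finsetSum fun i _ => hi i]
  have hcongr : ∫ t in (0 : ℝ)..T, ∑ i, wderiv (hflux B u i) (EuclideanSpace.single i 1, 0) (x, t)
      * φ t = ∫ t in (0 : ℝ)..T, (g t * φ t - u (x, t) * φ t
        - wderiv (wderiv u (0, 1)) (0, 1) (x, t) * φ t) := by
    refine intervalIntegral.integral_congr_ae (.of_forall fun t ht => ?_)
    rw [uIoc_of_le hT] at ht
    have := hu.split_equation (y := (x, t)) ht.1
    rw [← Finset.sum_mul, eq_sub_of_add_eq this]
    ring
  rw [hcongr, intervalIntegral.integral_sub (hgi.sub hui) hutt,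
    intervalIntegral.integral_sub hgi hui, hgreen]
  ring

end Modes

/-! ### Functions on `[0, 2π]` with vanishing Cauchy data -/

theorem sin_nat_mul_two_pi_eq (m : ℕ) : Real.sin (m * (2 * Real.pi)) = 0 := by
  rw [show (m : ℝ) * (2 * Real.pi) = ((m * 2 : ℕ) : ℝ) * Real.pi by push_cast; ring,
    Real.sin_nat_mul_pi]

theorem hasDerivAt_cos_nat_mul (m : ℕ) (t : ℝ) :
    HasDerivAt (fun t => Real.cos (m * t)) (-(m * Real.sin (m * t))) t := by
  have := ((hasDerivAt_id t).const_mul (m : ℝ)).cos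
  simp only [id, mul_one] at this
  exact this.congr_deriv (by ring)

theorem hasDerivAt_sin_nat_mul (m : ℕ) (t : ℝ) :
    HasDerivAt (fun t => Real.sin (m * t)) (m * Real.cos (m * t)) t := by
  have := ((hasDerivAt_id t).const_mul (m : ℝ)).sin
  simp only [id, mul_one] at this
  exact this.congr_deriv (by ring)

theorem integral_mul_cos_eq (g : ℝ → ℝ) (m : ℕ) :
    ∫ t in (0 : ℝ)..(2 * Real.pi), g t * Real.cos (m * t) = Real.pi * cosCoeff g m := by
  have := Real.pi_ne_zero
  rw [cosCoeff]
  field_simp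

theorem integral_mul_sin_eq (g : ℝ → ℝ) (m : ℕ) :
    ∫ t in (0 : ℝ)..(2 * Real.pi), g t * Real.sin (m * t) = Real.pi * sinCoeff g m := by
  have := Real.pi_ne_zero
  rw [sinCoeff]
  field_simp

/-- `m / (m² - 1)` is square summable, so its product with a square summable sequence is summable. -/
theorem summable_nat_mul_ratio {a : ℕ → ℝ} (ha : Summable fun m => a m ^ 2) :
    Summable fun k : ℕ => ((k + 2 : ℕ) : ℝ) * (a (k + 2) / (((k + 2 : ℕ) : ℝ) ^ 2 - 1)) := by
  have h1 : Summable fun k : ℕ => a (k + 2) ^ 2 := (summable_nat_add_iff 2).2 ha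
  have h2 : Summable fun k : ℕ => 4 * (1 / ((k + 2 : ℕ) : ℝ) ^ 2) :=
    ((summable_nat_add_iff 2).2 (Real.summable_one_div_nat_pow.2 one_lt_two)).mul_left 4
  refine Summable.of_norm_bounded (h1.add h2) fun k => ?_
  have hm : (2 : ℝ) ≤ ((k + 2 : ℕ) : ℝ) := by push_cast; linarith [(k.cast_nonneg : (0 : ℝ) ≤ k)]
  set m : ℝ := ((k + 2 : ℕ) : ℝ)
  have hr : m / (m ^ 2 - 1) ≤ 2 / m := by
    rw [div_le_div_iff₀ (by nlinarith) (by linarith)]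
    nlinarith
  have hr0 : 0 ≤ m / (m ^ 2 - 1) := div_nonneg (by linarith) (by nlinarith)
  have hr2 : (m / (m ^ 2 - 1)) ^ 2 ≤ 4 * (1 / m ^ 2) := by
    calc (m / (m ^ 2 - 1)) ^ 2 ≤ (2 / m) ^ 2 := pow_le_pow_left₀ hr0 hr 2
      _ = 4 * (1 / m ^ 2) := by ring
  rw [Real.norm_eq_abs, show m * (a (k + 2) / (m ^ 2 - 1)) = a (k + 2) * (m / (m ^ 2 - 1)) by ring,
    abs_le]
  constructor <;> nlinarith [sq_nonneg (a (k + 2) + m / (m ^ 2 - 1)),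
    sq_nonneg (a (k + 2) - m / (m ^ 2 - 1)), sq_nonneg (a (k + 2)), sq_nonneg (m / (m ^ 2 - 1))]

theorem Summable.of_nat_add_two_mul {b : ℕ → ℝ}
    (h : Summable fun k : ℕ => ((k + 2 : ℕ) : ℝ) * b k) : Summable b := by
  refine Summable.of_norm_bounded h.norm fun k => ?_
  rw [norm_mul, Real.norm_natCast]
  refine le_mul_of_one_le_left (norm_nonneg _) ?_
  push_cast
  linarith [(k.cast_nonneg : (0 : ℝ) ≤ k)]

theorem summable_nat_mul_cosRatio {g : ℝ → ℝ} (hg : ContinuousOn g (Icc 0 (2 * Real.pi))) :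
    Summable fun k : ℕ => ((k + 2 : ℕ) : ℝ) * cosRatio g (k + 2) :=
  summable_nat_mul_ratio ((summable_sq_coeff hg).of_nonneg_of_le (fun _ => sq_nonneg _)
    fun _ => le_add_of_nonneg_right (sq_nonneg _))

theorem summable_nat_mul_sinRatio {g : ℝ → ℝ} (hg : ContinuousOn g (Icc 0 (2 * Real.pi))) :
    Summable fun k : ℕ => ((k + 2 : ℕ) : ℝ) * sinRatio g (k + 2) :=
  summable_nat_mul_ratio ((summable_sq_coeff hg).of_nonneg_of_le (fun _ => sq_nonneg _)
    fun _ => le_add_of_nonneg_left (sq_nonneg _))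

theorem summable_ratio_series {g : ℝ → ℝ} (hg : ContinuousOn g (Icc 0 (2 * Real.pi))) (t : ℝ) :
    Summable (fun k : ℕ => cosRatio g (k + 2) * Real.cos ((k + 2 : ℕ) * t)
      + sinRatio g (k + 2) * Real.sin ((k + 2 : ℕ) * t)) := by
  refine Summable.add
    (Summable.of_norm_bounded (summable_nat_mul_cosRatio hg).of_nat_add_two_mul.norm fun k => ?_)
    (Summable.of_norm_bounded (summable_nat_mul_sinRatio hg).of_nat_add_two_mul.norm fun k => ?_)
  · rw [norm_mul]
    exact mul_le_of_le_one_right (norm_nonneg _) (Real.abs_cos_le_one _)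
  · rw [norm_mul]
    exact mul_le_of_le_one_right (norm_nonneg _) (Real.abs_sin_le_one _)

/-- Integration by parts in the Fourier coefficients of a function vanishing at the end points. -/
theorem coeff_deriv {f f' : ℝ → ℝ} (hf : ContinuousOn f (Icc 0 (2 * Real.pi)))
    (hf' : ContinuousOn f' (Icc 0 (2 * Real.pi)))
    (hd : ∀ t ∈ Ioo 0 (2 * Real.pi), HasDerivAt f (f' t) t) (h0 : f 0 = 0)
    (hpi : f (2 * Real.pi) = 0) (m : ℕ) :
    cosCoeff f' m = m * sinCoeff f m ∧ sinCoeff f' m = -(m * cosCoeff f m) := by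
  have hT := Real.two_pi_pos.le
  have hint : ∀ {h φ : ℝ → ℝ}, ContinuousOn h (Icc 0 (2 * Real.pi)) → Continuous φ →
      IntervalIntegrable (fun t => h t * φ t) MeasureTheory.volume 0 (2 * Real.pi) := by
    intro h φ hh hφ
    apply ContinuousOn.intervalIntegrable
    rw [uIcc_of_le hT]
    exact hh.mul hφ.continuousOn
  have hc : Continuous fun t : ℝ => Real.cos (m * t) := by fun_prop
  have hs : Continuous fun t : ℝ => Real.sin (m * t) := by fun_prop
  have key : ∀ φ φ' : ℝ → ℝ, Continuous φ → Continuous φ' → (∀ t, HasDerivAt φ (φ' t) t) →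
      (∫ t in (0 : ℝ)..(2 * Real.pi), f' t * φ t)
        + ∫ t in (0 : ℝ)..(2 * Real.pi), f t * φ' t = 0 := by
    intro φ φ' hφ hφ' hφd
    rw [← intervalIntegral.integral_add (hint hf' hφ) (hint hf hφ'),
      intervalIntegral.integral_eq_sub_of_hasDerivAt_of_le hT (f := fun t => f t * φ t)
        (hf.mul hφ.continuousOn) (fun t ht => (hd t ht).mul (hφd t))
        ((hint hf' hφ).add (hint hf hφ')), h0, hpi]
    ring
  have k1 := key _ _ hc (by fun_prop) (hasDerivAt_cos_nat_mul m)
  have k2 := key _ _ hs (by fun_prop) (hasDerivAt_sin_nat_mul m)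
  have e1 : ∫ t in (0 : ℝ)..(2 * Real.pi), f t * -(m * Real.sin (m * t))
      = -(m * (Real.pi * sinCoeff f m)) := by
    rw [← integral_mul_sin_eq, ← intervalIntegral.integral_const_mul,
      ← intervalIntegral.integral_neg]
    congr 1
    ext t
    ring
  have e2 : ∫ t in (0 : ℝ)..(2 * Real.pi), f t * (m * Real.cos (m * t))
      = m * (Real.pi * cosCoeff f m) := by
    rw [← integral_mul_cos_eq, ← intervalIntegral.integral_const_mul]
    congr 1
    ext t
    ring
  rw [integral_mul_cos_eq, e1] at k1
  rw [integral_mul_sin_eq, e2] at k2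
  constructor <;> refine mul_left_cancel₀ Real.pi_ne_zero ?_ <;> linarith

/-- A function with vanishing Cauchy data at both end points of `[0, 2π]` is determined by its
Fourier coefficients of index `0` and `≥ 2`: inverting the Fourier series of `f` and of `f'` at `0`
gives the coefficients of index `1`. -/
theorem eq_series_of_coeff {f f' g : ℝ → ℝ} (hg : ContinuousOn g (Icc 0 (2 * Real.pi)))
    (hf : ContinuousOn f (Icc 0 (2 * Real.pi))) (hf' : ContinuousOn f' (Icc 0 (2 * Real.pi)))
    (hd : ∀ t ∈ Ioo 0 (2 * Real.pi), HasDerivAt f (f' t) t) (h0 : f 0 = 0)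
    (hpi : f (2 * Real.pi) = 0) (h0' : f' 0 = 0) (hpi' : f' (2 * Real.pi) = 0)
    (hc : ∀ k, cosCoeff f (k + 2) = -cosRatio g (k + 2))
    (hs : ∀ k, sinCoeff f (k + 2) = -sinRatio g (k + 2)) :
    cosCoeff f 1 = -(cosCoeff f 0 / 2) + ∑' k : ℕ, cosRatio g (k + 2) ∧
    ∀ t ∈ Icc 0 (2 * Real.pi), f t = cosCoeff f 0 / 2
        + (-(cosCoeff f 0 / 2) + ∑' k : ℕ, cosRatio g (k + 2)) * Real.cos t
        + (∑' k : ℕ, ((k + 2 : ℕ) : ℝ) * sinRatio g (k + 2)) * Real.sin t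
        - ∑' k : ℕ, (cosRatio g (k + 2) * Real.cos ((k + 2 : ℕ) * t)
          + sinRatio g (k + 2) * Real.sin ((k + 2 : ℕ) * t)) := by
  have hmc := summable_nat_mul_cosRatio hg
  have hms := summable_nat_mul_sinRatio hg
  have hco := fun m => (coeff_deriv hf hf' hd h0 hpi m).1
  have hsi := fun m => (coeff_deriv hf hf' hd h0 hpi m).2
  have hfc : Summable (cosCoeff f) := (summable_nat_add_iff 2).1 <| by
    simp_rw [hc]
    exact hmc.of_nat_add_two_mul.neg
  have hfs : Summable (sinCoeff f) := (summable_nat_add_iff 2).1 <| by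
    simp_rw [hs]
    exact hms.of_nat_add_two_mul.neg
  have hfc' : Summable (cosCoeff f') := (summable_nat_add_iff 2).1 <| by
    simp_rw [hco, hs, mul_neg]
    exact hms.neg
  have hfs' : Summable (sinCoeff f') := (summable_nat_add_iff 2).1 <| by
    simp_rw [hsi, hc, mul_neg, neg_neg]
    exact hmc
  have hinv : ∀ t ∈ Icc 0 (2 * Real.pi), f t = cosCoeff f 0 / 2 + cosCoeff f 1 * Real.cos t
      + sinCoeff f 1 * Real.sin t
      - ∑' k : ℕ, (cosRatio g (k + 2) * Real.cos ((k + 2 : ℕ) * t)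
          + sinRatio g (k + 2) * Real.sin ((k + 2 : ℕ) * t)) := by
    intro t ht
    have h1 := hasSum_fourier_of_summable hf (h0.trans hpi.symm) hfc hfs ht
    have h2 := h1.summable.tsum_eq_zero_add
    rw [h1.tsum_eq] at h2
    have h3 : ∀ k : ℕ, cosCoeff f (k + 1 + 1) * Real.cos ((k + 1 + 1 : ℕ) * t)
        + sinCoeff f (k + 1 + 1) * Real.sin ((k + 1 + 1 : ℕ) * t)
        = -(cosRatio g (k + 2) * Real.cos ((k + 2 : ℕ) * t)
          + sinRatio g (k + 2) * Real.sin ((k + 2 : ℕ) * t)) := fun k => by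
      rw [show k + 1 + 1 = k + 2 from rfl, hc, hs]
      ring
    simp_rw [h3] at h2
    rw [tsum_neg] at h2
    simp only [zero_add, Nat.cast_one, one_mul] at h2
    linarith
  have hα : cosCoeff f 1 = -(cosCoeff f 0 / 2) + ∑' k : ℕ, cosRatio g (k + 2) := by
    have := hinv 0 ⟨le_rfl, Real.two_pi_pos.le⟩
    simp only [mul_zero, Real.cos_zero, Real.sin_zero, mul_one, add_zero, h0] at this
    linarith
  have hβ : sinCoeff f 1 = ∑' k : ℕ, ((k + 2 : ℕ) : ℝ) * sinRatio g (k + 2) := by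
    have h1 := hasSum_fourier_of_summable hf' (h0'.trans hpi'.symm) hfc' hfs'
      (left_mem_Icc.2 Real.two_pi_pos.le)
    have h2 := h1.summable.tsum_eq_zero_add
    rw [h1.tsum_eq] at h2
    have h3 : ∀ k : ℕ, cosCoeff f' (k + 1 + 1) * Real.cos ((k + 1 + 1 : ℕ) * 0)
        + sinCoeff f' (k + 1 + 1) * Real.sin ((k + 1 + 1 : ℕ) * 0)
        = -(((k + 2 : ℕ) : ℝ) * sinRatio g (k + 2)) := fun k => by
      rw [show k + 1 + 1 = k + 2 from rfl, hco, hs]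
      simp
    simp_rw [h3] at h2
    rw [tsum_neg, h0', hco, hco] at h2
    simp only [zero_add, Nat.cast_one, one_mul, mul_zero, Real.cos_zero, mul_one, Real.sin_zero,
      add_zero, Nat.cast_zero, zero_mul, zero_div, sub_zero] at h2
    linarith
  refine ⟨hα, fun t ht => ?_⟩
  rw [hinv t ht, hα, hβ]

/-! ### Uniqueness for the one-dimensional problem -/

namespace IsODESolution

variable {g v w : ℝ → ℝ}

theorem hasDerivAt (hv : IsODESolution g v) {t : ℝ} (ht : t ∈ Ioo 0 (2 * Real.pi)) :
    HasDerivAt v (derivWithin v (Icc 0 (2 * Real.pi)) t) t ∧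
      HasDerivAt (derivWithin v (Icc 0 (2 * Real.pi))) (g t - v t) t := by
  have hIcc : ∀ s ∈ Ioo 0 (2 * Real.pi), Icc 0 (2 * Real.pi) ∈ nhds s := fun s hs =>
    Icc_mem_nhds hs.1 hs.2
  have h1 : ∀ s ∈ Ioo 0 (2 * Real.pi), derivWithin v (Icc 0 (2 * Real.pi)) s = deriv v s :=
    fun s hs => derivWithin_of_mem_nhds (hIcc s hs)
  have hnhds : Ioo 0 (2 * Real.pi) ∈ nhds t := Ioo_mem_nhds ht.1 ht.2
  have hC := hv.contDiffOn_Ioo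
  constructor
  · rw [h1 t ht]
    exact (((hC.differentiableOn (by norm_num)) t ht).differentiableAt hnhds).hasDerivAt
  · have h2 : ContDiffOn ℝ 1 (deriv v) (Ioo 0 (2 * Real.pi)) :=
      hC.deriv_of_isOpen isOpen_Ioo (by norm_num)
    have h3 := (((h2.differentiableOn (by norm_num)) t ht).differentiableAt hnhds).hasDerivAt
    have h4 := hv.equation t ht
    rw [show g t - v t = deriv (deriv v) t by linarith]
    exact h3.congr_of_eventuallyEq (Filter.eventuallyEq_of_mem hnhds h1)

/-- Uniqueness: the energy `e² + e'²` of the difference `e` of two solutions is conserved. -/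
theorem eqOn (hv : IsODESolution g v) (hw : IsODESolution g w) :
    EqOn w v (Icc 0 (2 * Real.pi)) := by
  intro t ht
  let p : ℝ → ℝ := fun s =>
    derivWithin w (Icc 0 (2 * Real.pi)) s - derivWithin v (Icc 0 (2 * Real.pi)) s
  let E : ℝ → ℝ := fun s => (w s - v s) ^ 2 + p s ^ 2
  have hp : ContinuousOn p (Icc 0 (2 * Real.pi)) :=
    (hw.contDiffOn_Icc.continuousOn_derivWithin (uniqueDiffOn_Icc Real.two_pi_pos)
      (by norm_num)).sub (hv.contDiffOn_Icc.continuousOn_derivWithin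
        (uniqueDiffOn_Icc Real.two_pi_pos) (by norm_num))
  have hE : ContinuousOn E (Icc 0 (2 * Real.pi)) :=
    ((hw.contDiffOn_Icc.continuousOn.sub hv.contDiffOn_Icc.continuousOn).pow 2).add (hp.pow 2)
  have hE0 : E 0 = 0 := by
    simp [E, p, hv.left, hw.left, hv.deriv_left, hw.deriv_left]
  have hEt : E t = 0 := by
    rcases ht.1.eq_or_lt with rfl | h
    · exact hE0
    · obtain ⟨c, hc, hc'⟩ := exists_hasDerivAt_eq_slope E (fun _ => 0) h
        (hE.mono (Icc_subset_Icc_right ht.2)) fun s hs => by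
          have hs' : s ∈ Ioo 0 (2 * Real.pi) := ⟨hs.1, hs.2.trans_le ht.2⟩
          obtain ⟨a1, a2⟩ := hv.hasDerivAt hs'
          obtain ⟨b1, b2⟩ := hw.hasDerivAt hs'
          refine (((b1.sub a1).pow 2).add ((b2.sub a2).pow 2)).congr_deriv ?_
          simp
          ring
      rw [eq_comm, div_eq_zero_iff] at hc'
      rcases hc' with h1 | h1 <;> linarith
  have : (w t - v t) ^ 2 = 0 := by
    have h1 : (w t - v t) ^ 2 + p t ^ 2 = 0 := hEt
    nlinarith [sq_nonneg (w t - v t), sq_nonneg (p t)]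
  exact sub_eq_zero.1 (pow_eq_zero_iff two_ne_zero |>.1 this)

end IsODESolution

/-! ### One-dimensionality of the solution -/

section OneDimensional

variable {n : ℕ} {B : EuclideanSpace ℝ (Fin n) → Matrix (Fin n) (Fin n) ℝ} {g : ℝ → ℝ}
  {u : Pt n → ℝ}

namespace IsHalfSpaceSolution

theorem cos_mode_equation (hB : IsAdmissible B) (hg : Continuous g)
    (hu : IsHalfSpaceSolution (blockMatrix B) g u) (m : ℕ) :
    ContDiff ℝ 1 (fun x => ∫ t in (0 : ℝ)..(2 * Real.pi), u (x, t) * Real.cos (m * t)) ∧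
    (∀ i, ContDiff ℝ 1
      (flux B (fun x => ∫ t in (0 : ℝ)..(2 * Real.pi), u (x, t) * Real.cos (m * t)) i)) ∧
    ∀ x, ∑ i, pderiv i
        (flux B (fun x => ∫ t in (0 : ℝ)..(2 * Real.pi), u (x, t) * Real.cos (m * t)) i) x =
      ((m : ℝ) ^ 2 - 1) * (∫ t in (0 : ℝ)..(2 * Real.pi), u (x, t) * Real.cos (m * t))
      + (Real.pi * cosCoeff g m - wderiv u (0, 1) (x, 2 * Real.pi) + wderiv u (0, 1) (x, 0)) := by
  obtain ⟨h1, h2, h3⟩ := hu.mode_equation hB hg (k := (m : ℝ) ^ 2) (hasDerivAt_cos_nat_mul m)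
    (fun t => ((hasDerivAt_sin_nat_mul m t).const_mul (m : ℝ)).neg.congr_deriv (by ring))
    Real.two_pi_pos.le
  refine ⟨h1, h2, fun x => ?_⟩
  rw [h3 x, integral_mul_cos_eq g, Real.cos_nat_mul_two_pi, sin_nat_mul_two_pi_eq, mul_zero,
    Real.cos_zero]
  ring

theorem sin_mode_equation (hB : IsAdmissible B) (hg : Continuous g)
    (hu : IsHalfSpaceSolution (blockMatrix B) g u) (m : ℕ) :
    ContDiff ℝ 1 (fun x => ∫ t in (0 : ℝ)..(2 * Real.pi), u (x, t) * Real.sin (m * t)) ∧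
    (∀ i, ContDiff ℝ 1
      (flux B (fun x => ∫ t in (0 : ℝ)..(2 * Real.pi), u (x, t) * Real.sin (m * t)) i)) ∧
    ∀ x, ∑ i, pderiv i
        (flux B (fun x => ∫ t in (0 : ℝ)..(2 * Real.pi), u (x, t) * Real.sin (m * t)) i) x =
      ((m : ℝ) ^ 2 - 1) * (∫ t in (0 : ℝ)..(2 * Real.pi), u (x, t) * Real.sin (m * t))
      + (Real.pi * sinCoeff g m + m * u (x, 2 * Real.pi)) := by
  obtain ⟨h1, h2, h3⟩ := hu.mode_equation hB hg (k := (m : ℝ) ^ 2) (hasDerivAt_sin_nat_mul m)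
    (fun t => ((hasDerivAt_cos_nat_mul m t).const_mul (m : ℝ)).congr_deriv (by ring))
    Real.two_pi_pos.le
  refine ⟨h1, h2, fun x => ?_⟩
  rw [h3 x, integral_mul_sin_eq g, Real.cos_nat_mul_two_pi, sin_nat_mul_two_pi_eq,
    mul_zero (m : ℝ), Real.sin_zero]
  ring

end IsHalfSpaceSolution

/-- Modes of `u` over `[0, 2π]` are bounded. -/
theorem NonnegBoundedOnStrips.exists_mode_bound (hb : NonnegBoundedOnStrips u) :
    ∃ K : ℝ, ∀ φ : ℝ → ℝ, (∀ t, |φ t| ≤ 1) → ∀ x : EuclideanSpace ℝ (Fin n),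
      |∫ t in (0 : ℝ)..(2 * Real.pi), u (x, t) * φ t| ≤ K := by
  obtain ⟨C, hC0, hC⟩ := hb (2 * Real.pi) Real.two_pi_pos
  refine ⟨C * |2 * Real.pi - 0|, fun φ hφ x => ?_⟩
  refine intervalIntegral.norm_integral_le_of_norm_le_const
    (f := fun t => u (x, t) * φ t) fun t ht => ?_
  rw [uIoc_of_le Real.two_pi_pos.le] at ht
  have := hC (x, t) ⟨ht.1.le, ht.2⟩
  rw [Real.norm_eq_abs, abs_mul, abs_of_nonneg this.1]
  exact (mul_le_mul this.2 (hφ t) (abs_nonneg _) hC0.le).trans_eq (mul_one C)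

theorem NonnegBoundedOnStrips.nonneg (hb : NonnegBoundedOnStrips u) {x : Pt n} (hx : 0 ≤ x.2) :
    0 ≤ u x := by
  obtain ⟨C, -, hC⟩ := hb (x.2 + 1) (by linarith)
  exact (hC x ⟨hx, by linarith⟩).1

namespace IsHalfSpaceSolution

/-- The sine mode of frequency `1` is a bounded subsolution; its constancy forces `d_1 = 0` and
`u = 0` at height `2π`. -/
theorem sinCoeff_one_eq_zero (hn : n ≤ 2) (hB : IsAdmissible B) (hg : Continuous g)
    (hd : 0 ≤ sinCoeff g 1) (hu : IsHalfSpaceSolution (blockMatrix B) g u)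
    (hb : NonnegBoundedOnStrips u) :
    sinCoeff g 1 = 0 ∧ ∀ x, u (x, 2 * Real.pi) = 0 := by
  obtain ⟨K, hK⟩ := hb.exists_mode_bound
  obtain ⟨h1, h2, h3⟩ := hu.sin_mode_equation hB hg 1
  have hK' := hK (fun t => Real.sin ((1 : ℕ) * t)) fun t => Real.abs_sin_le_one _
  have hu0 : ∀ x, 0 ≤ u (x, 2 * Real.pi) := fun x => hb.nonneg Real.two_pi_pos.le
  simp only [Nat.cast_one, one_pow, sub_self, zero_mul, zero_add, one_mul] at h1 h2 h3 hK'
  have hpd : 0 ≤ Real.pi * sinCoeff g 1 := mul_nonneg Real.pi_pos.le hd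
  have h4 := fderiv_eq_zero_of_subsolution hn hB h1 h2 hK'
    fun x => by rw [h3 x]; exact add_nonneg hpd (hu0 x)
  have h5 : ∀ x, Real.pi * sinCoeff g 1 + u (x, 2 * Real.pi) = 0 := fun x => by
    rw [← h3 x, div_flux_eq_zero h4]
  refine ⟨?_, fun x => by linarith [h5 x, hu0 x]⟩
  have : Real.pi * sinCoeff g 1 = 0 := by linarith [h5 0, hu0 0]
  exact (mul_eq_zero.1 this).resolve_left Real.pi_ne_zero

/-- `u ≥ 0` touches `0` from above at height `2π`. -/
theorem wderiv_two_pi_eq_zero (hu : IsHalfSpaceSolution (blockMatrix B) g u)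
    (hb : NonnegBoundedOnStrips u) {x : EuclideanSpace ℝ (Fin n)} (h : u (x, 2 * Real.pi) = 0) :
    wderiv u (0, 1) (x, 2 * Real.pi) = 0 := by
  have hu1 : ContDiffOn ℝ 1 u (halfSpace n) :=
    ContDiffOn.of_le (n := 2) hu.contDiffOn (by norm_num)
  refine IsLocalMin.hasDerivAt_eq_zero ?_ (hu1.hasDerivAt_vertical x Real.two_pi_pos)
  filter_upwards [Ioi_mem_nhds Real.two_pi_pos] with t ht
  rw [h]
  exact hb.nonneg (le_of_lt (mem_Ioi.1 ht))

theorem wderiv_zero_nonneg (hu : IsHalfSpaceSolution (blockMatrix B) g u)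
    (hb : NonnegBoundedOnStrips u) (x : EuclideanSpace ℝ (Fin n)) :
    0 ≤ wderiv u (0, 1) (x, 0) := by
  have hu1 : ContDiffOn ℝ 1 u (halfSpace n) :=
    ContDiffOn.of_le (n := 2) hu.contDiffOn (by norm_num)
  have h := (hu1.hasDerivWithinAt_vertical x le_rfl).mono Ioi_subset_Ici_self
  refine ge_of_tendsto ((hasDerivWithinAt_iff_tendsto_slope' self_notMem_Ioi).1 h) ?_
  filter_upwards [self_mem_nhdsWithin] with t ht
  have ht' : 0 < t := ht
  rw [slope_def_field, hu.boundary, sub_zero, sub_zero]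
  exact div_nonneg (hb.nonneg ht'.le) ht'.le

/-- The cosine mode of frequency `1` is a bounded subsolution; its constancy forces `c_1 = 0` and
`∂_N u = 0` on the boundary. -/
theorem cosCoeff_one_eq_zero (hn : n ≤ 2) (hB : IsAdmissible B) (hg : Continuous g)
    (hc : 0 ≤ cosCoeff g 1) (hu : IsHalfSpaceSolution (blockMatrix B) g u)
    (hb : NonnegBoundedOnStrips u) (h2π : ∀ x, u (x, 2 * Real.pi) = 0) :
    cosCoeff g 1 = 0 ∧ (∀ x, wderiv u (0, 1) (x, 0) = 0) ∧
      ∀ x y, cosCoeff (fun t => u (x, t)) 1 = cosCoeff (fun t => u (y, t)) 1 := by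
  obtain ⟨K, hK⟩ := hb.exists_mode_bound
  obtain ⟨h1, h2, h3⟩ := hu.cos_mode_equation hB hg 1
  have hK' := hK (fun t => Real.cos ((1 : ℕ) * t)) fun t => Real.abs_cos_le_one _
  have h0 : ∀ x, wderiv u (0, 1) (x, 2 * Real.pi) = 0 := fun x =>
    hu.wderiv_two_pi_eq_zero hb (h2π x)
  have hu0 : ∀ x, 0 ≤ wderiv u (0, 1) (x, 0) := hu.wderiv_zero_nonneg hb
  simp only [h0, Nat.cast_one, one_pow, sub_self, zero_mul, zero_add, one_mul, sub_zero]
    at h1 h2 h3 hK'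
  have hpd : 0 ≤ Real.pi * cosCoeff g 1 := mul_nonneg Real.pi_pos.le hc
  have h4 := fderiv_eq_zero_of_subsolution hn hB h1 h2 hK'
    fun x => by rw [h3 x]; exact add_nonneg hpd (hu0 x)
  have h5 : ∀ x, Real.pi * cosCoeff g 1 + wderiv u (0, 1) (x, 0) = 0 := fun x => by
    rw [← h3 x, div_flux_eq_zero h4]
  refine ⟨?_, fun x => by linarith [h5 x, hu0 x], fun x y => ?_⟩
  · have : Real.pi * cosCoeff g 1 = 0 := by linarith [h5 0, hu0 0]
    exact (mul_eq_zero.1 this).resolve_left Real.pi_ne_zero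
  · simp only [cosCoeff, Nat.cast_one, one_mul]
    rw [eq_of_fderiv_eq_zero h1 h4 x y]

/-- Once `u` has vanishing Cauchy data at heights `0` and `2π`, its modes of frequency `m ≥ 2`
solve `div (B ∇w) = (m² - 1) w + π c_m`, and similarly with `d_m`, so they are constants. -/
theorem coeff_eq (hn : n ≤ 2) (hB : IsAdmissible B) (hg : Continuous g)
    (hu : IsHalfSpaceSolution (blockMatrix B) g u) (hb : NonnegBoundedOnStrips u)
    (h2π : ∀ x, u (x, 2 * Real.pi) = 0) (h0' : ∀ x, wderiv u (0, 1) (x, 0) = 0)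
    (x : EuclideanSpace ℝ (Fin n)) (k : ℕ) :
    cosCoeff (fun t => u (x, t)) (k + 2) = -cosRatio g (k + 2) ∧
      sinCoeff (fun t => u (x, t)) (k + 2) = -sinRatio g (k + 2) := by
  obtain ⟨K, hK⟩ := hb.exists_mode_bound
  have h0 : ∀ x, wderiv u (0, 1) (x, 2 * Real.pi) = 0 := fun x =>
    hu.wderiv_two_pi_eq_zero hb (h2π x)
  have hm : 0 < ((k + 2 : ℕ) : ℝ) ^ 2 - 1 := by
    push_cast
    nlinarith [(k.cast_nonneg : (0 : ℝ) ≤ k)]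
  constructor
  · obtain ⟨h1, h2, h3⟩ := hu.cos_mode_equation hB hg (k + 2)
    simp only [h0, h0', sub_zero, add_zero] at h3
    have h4 := eq_zero_of_screened hn hB h1 h2
      (hK (fun t => Real.cos ((k + 2 : ℕ) * t)) fun t => Real.abs_cos_le_one _) hm h3 x
    rw [integral_mul_cos_eq (fun t => u (x, t))] at h4
    rw [cosRatio, ← neg_div, eq_div_iff hm.ne']
    refine mul_left_cancel₀ Real.pi_ne_zero ?_
    linarith
  · obtain ⟨h1, h2, h3⟩ := hu.sin_mode_equation hB hg (k + 2)
    simp only [h2π, mul_zero, add_zero] at h3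
    have h4 := eq_zero_of_screened hn hB h1 h2
      (hK (fun t => Real.sin ((k + 2 : ℕ) * t)) fun t => Real.abs_sin_le_one _) hm h3 x
    rw [integral_mul_sin_eq (fun t => u (x, t))] at h4
    rw [sinRatio, ← neg_div, eq_div_iff hm.ne']
    refine mul_left_cancel₀ Real.pi_ne_zero ?_
    linarith

/-- If `u` does not depend on `x'` on the strip and has vanishing Cauchy data at heights `0` and
`2π`, its profile solves the one-dimensional problem. -/
theorem isODESolution (hu : IsHalfSpaceSolution (blockMatrix B) g u)
    (h2π : ∀ x, u (x, 2 * Real.pi) = 0) (h0' : ∀ x, wderiv u (0, 1) (x, 0) = 0)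
    (h2π' : ∀ x, wderiv u (0, 1) (x, 2 * Real.pi) = 0)
    (hconst : ∀ x, ∀ t ∈ Icc 0 (2 * Real.pi), u (x, t) = u (0, t)) :
    IsODESolution g (fun t => u (0, t)) := by
  have hu2 : ContDiffOn ℝ 2 u (halfSpace n) := hu.contDiffOn
  have hu1 : ContDiffOn ℝ 1 u (halfSpace n) := hu2.of_le (by norm_num)
  have hslice : ContDiffOn ℝ 2 (fun t => u (0, t)) (Ici 0) :=
    hu2.comp (contDiff_prodMk_right 0).contDiffOn fun t ht => ht
  have hdw : ∀ t ∈ Icc 0 (2 * Real.pi),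
      derivWithin (fun t => u (0, t)) (Icc 0 (2 * Real.pi)) t = wderiv u (0, 1) (0, t) :=
    fun t ht => ((hu1.hasDerivWithinAt_vertical 0 ht.1).mono Icc_subset_Ici_self).derivWithin
      (uniqueDiffOn_Icc Real.two_pi_pos t ht)
  refine ⟨hslice.mono fun t ht => ht.1.le,
    (hslice.of_le (by norm_num)).mono fun t ht => ht.1, fun t ht => ?_, hu.boundary 0, h2π 0,
    ?_, ?_⟩
  · -- the horizontal derivatives vanish inside the strip, hence so does the horizontal divergence
    have hopen : IsOpen {y : Pt n | y.2 ∈ Ioo 0 (2 * Real.pi)} :=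
      isOpen_Ioo.preimage continuous_snd
    have hh : ∀ y : Pt n, y.2 ∈ Ioo 0 (2 * Real.pi) → ∀ j : Fin n,
        wderiv u (EuclideanSpace.single j 1, 0) y = 0 := by
      intro y hy j
      have h1 := hu1.hasFDerivAt_horizontal y.1 hy.1.le
      have h2 : (fun x => u (x, y.2)) = fun _ => u (0, y.2) :=
        funext fun x => hconst x y.2 ⟨hy.1.le, hy.2.le⟩
      rw [h2] at h1
      have h3 := h1.unique (hasFDerivAt_const _ _)
      have h4 := congrArg (fun L => L (EuclideanSpace.single j 1)) h3
      simpa [wderiv] using h4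
    have hq : ∀ i : Fin n, wderiv (hflux B u i) (EuclideanSpace.single i 1, 0) (0, t) = 0 := by
      intro i
      rw [wderiv, ← fderiv_eq_fderivWithin_halfSpace _ (show (0 : ℝ) < (0, t).2 from ht.1)]
      have h1 : hflux B u i =ᶠ[nhds ((0, t) : Pt n)] fun _ => 0 := by
        filter_upwards [hopen.mem_nhds (show ((0, t) : Pt n).2 ∈ Ioo 0 (2 * Real.pi) from ht)]
          with y hy
        simp [hflux, hh y hy]
      rw [h1.fderiv_eq]
      simp
    have heq := hu.split_equation (y := (0, t)) ht.1
    simp only [hq, Finset.sum_const_zero, zero_add] at heq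
    have hd : deriv (fun t => u (0, t)) =ᶠ[nhds t] fun s => wderiv u (0, 1) (0, s) := by
      filter_upwards [Ioi_mem_nhds ht.1] with s hs
      exact (hu1.hasDerivAt_vertical 0 hs).deriv
    rw [hd.deriv_eq, ((hu2.wderiv (0, 1)).hasDerivAt_vertical 0 ht.1).deriv, heq]
    ring
  · rw [hdw 0 (left_mem_Icc.2 Real.two_pi_pos.le), h0']
  · rw [hdw _ (right_mem_Icc.2 Real.two_pi_pos.le), h2π']

end IsHalfSpaceSolution

end OneDimensional

theorem mainTheorem5 (n : ℕ) (hN : n + 1 = 2 ∨ n + 1 = 3)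
    (B : EuclideanSpace ℝ (Fin n) → Matrix (Fin n) (Fin n) ℝ) (hB : IsAdmissible B)
    (g : ℝ → ℝ) (hg : Continuous g) (hc : 0 ≤ cosCoeff g 1) (hd : 0 ≤ sinCoeff g 1)
    (u : EuclideanSpace ℝ (Fin n) × ℝ → ℝ)
    (hu : IsHalfSpaceSolution (blockMatrix B) g u) (hb : NonnegBoundedOnStrips u) :
    -- the first Fourier coefficients of `g` vanish
    (cosCoeff g 1 = 0 ∧ sinCoeff g 1 = 0) ∧
    -- `u` is one-dimensional on the closed strip, where it is the unique solution of the ODE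
    (∃ v : ℝ → ℝ, IsODESolution g v ∧
      (∀ w : ℝ → ℝ, IsODESolution g w → EqOn w v (Icc 0 (2 * Real.pi))) ∧
      ∀ x' : EuclideanSpace ℝ (Fin n), ∀ t ∈ Icc 0 (2 * Real.pi), u (x', t) = v t) ∧
    -- the series below, over the indices `m = k + 2 ≥ 2`, converge absolutely, and they give `u`
    Summable (fun k : ℕ => cosRatio g (k + 2)) ∧
    Summable (fun k : ℕ => ((k + 2 : ℕ) : ℝ) * sinRatio g (k + 2)) ∧
    (∀ t : ℝ, Summable (fun k : ℕ => cosRatio g (k + 2) * Real.cos ((k + 2 : ℕ) * t)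
      + sinRatio g (k + 2) * Real.sin ((k + 2 : ℕ) * t))) ∧
    ∀ x' : EuclideanSpace ℝ (Fin n), ∀ t ∈ Icc 0 (2 * Real.pi),
      u (x', t) = cosCoeff g 0 / 2
        + (-(cosCoeff g 0 / 2) + ∑' k : ℕ, cosRatio g (k + 2)) * Real.cos t
        + (∑' k : ℕ, ((k + 2 : ℕ) : ℝ) * sinRatio g (k + 2)) * Real.sin t
        - ∑' k : ℕ, (cosRatio g (k + 2) * Real.cos ((k + 2 : ℕ) * t)
          + sinRatio g (k + 2) * Real.sin ((k + 2 : ℕ) * t)) := by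
  have hn : n ≤ 2 := by omega
  have hgc : ContinuousOn g (Icc 0 (2 * Real.pi)) := hg.continuousOn
  have hu2 : ContDiffOn ℝ 2 u (halfSpace n) := hu.contDiffOn
  have hu1 : ContDiffOn ℝ 1 u (halfSpace n) := hu2.of_le (by norm_num)
  obtain ⟨hd1, h2π⟩ := hu.sinCoeff_one_eq_zero hn hB hg hd hb
  obtain ⟨hc1, h0', hα⟩ := hu.cosCoeff_one_eq_zero hn hB hg hc hb h2π
  have h2π' := fun x => hu.wderiv_two_pi_eq_zero hb (h2π x)
  have hser := fun x => eq_series_of_coeff hgc (f := fun t => u (x, t))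
    (f' := fun t => wderiv u (0, 1) (x, t)) (continuousOn_slice hu1.continuousOn x)
    (continuousOn_slice (hu2.wderiv (0, 1)).continuousOn x)
    (fun t ht => hu1.hasDerivAt_vertical x ht.1) (hu.boundary x) (h2π x) (h0' x) (h2π' x)
    (fun k => (hu.coeff_eq hn hB hg hb h2π h0' x k).1)
    (fun k => (hu.coeff_eq hn hB hg hb h2π h0' x k).2)
  -- the mean over a period is tied to the cosine mode of frequency `1`, which is constant
  have hmean : ∀ x y, cosCoeff (fun t => u (x, t)) 0 = cosCoeff (fun t => u (y, t)) 0 :=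
    fun x y => by linarith [hα x y, (hser x).1, (hser y).1]
  have hmean_eq : ∀ x, cosCoeff (fun t => u (x, t)) 0 = cosCoeff g 0 := by
    intro x
    obtain ⟨h1, h2, h3⟩ := hu.cos_mode_equation hB hg 0
    have hconst : ∀ y, fderiv ℝ
        (fun x => ∫ t in (0 : ℝ)..(2 * Real.pi), u (x, t) * Real.cos ((0 : ℕ) * t)) y = 0 := by
      intro y
      have : (fun x => ∫ t in (0 : ℝ)..(2 * Real.pi), u (x, t) * Real.cos ((0 : ℕ) * t))
          = fun _ => Real.pi * cosCoeff (fun t => u (x, t)) 0 := by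
        ext y
        rw [integral_mul_cos_eq (fun t => u (y, t)), hmean y x]
      rw [this]
      simp
    have h4 := h3 x
    rw [div_flux_eq_zero hconst, integral_mul_cos_eq (fun t => u (x, t)), h0', h2π'] at h4
    refine mul_left_cancel₀ Real.pi_ne_zero ?_
    simp only [Nat.cast_zero] at h4
    linarith
  have hform := fun x => (hser x).2
  simp only [hmean_eq] at hform
  have hode := hu.isODESolution h2π h0' h2π'
    fun x t ht => (hform x t ht).trans (hform 0 t ht).symm
  exact ⟨⟨hc1, hd1⟩, ⟨_, hode, fun w hw => hode.eqOn hw,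
      fun x t ht => (hform x t ht).trans (hform 0 t ht).symm⟩,
    (summable_nat_mul_cosRatio hgc).of_nat_add_two_mul, summable_nat_mul_sinRatio hgc,
    summable_ratio_series hgc, hform⟩
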